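/- Let $A$ be a Hermitian operator on $\mathbb{C}^4$ with simple eigenvalues $a_1<a_2<a_3<a_4$, and let $\psi$ be distributed according to the uniform (unitarily invariant) probability measure on the unit sphere of $\mathbb{C}^4$. Put $\langle A\rangle_\psi=\langle\psi|A|\psi\rangle$ and $\Delta_\psi A=\sqrt{\langle A^2\rangle_\psi-\langle A\rangle_\psi^2}$. Let $V_4=\prod_{1\le i<j\le 4}(a_j-a_i)$, $\varphi_{ij}(r)=(a_i+a_j)r-a_ia_j$, $r_*=\dfrac{a_2a_4-a_1a_3}{a_2+a_4-a_1-a_3}$ and $q_{ij}(r)=\sqrt{(a_j-r)(r-a_i)}$. Write $$D[u,v;ij,kl]=\{(r,s):u\le r\le v,\ \varphi_{ij}(r)\le s\le\varphi_{kl}(r)\},\qquad R[u,v;ij,kl]=\{(r,x):u\le r\le v,\ q_{ij}(r)\le x\le q_{kl}(r)\}$$ (the radicands are nonnegative on the intervals used below), and for $X\in\{D,R\}$ let $$X^{(1)}_1=X[a_1,a_2;12,13],\quad X^{(1)}_2=X[a_1,a_2;13,14],$$ $$X^{(2)}_1=X[a_2,r_*;23,24],\quad X^{(2)}_2=X[a_2,r_*;24,13],\quad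 X^{(2)}_3=X[a_2,r_*;13,14],$$ $$X^{(2)}_4=X[r_*,a_3;23,13],\quad X^{(2)}_5=X[r_*,a_3;13,24],\quad X^{(2)}_6=X[r_*,a_3;24,14],$$ $$X^{(3)}_1=X[a_3,a_4;34,24],\quad X^{(3)}_2=X[a_3,a_4;24,14].$$ Let $$g(r,s)=\begin{cases}(a_4-a_3)(s-\varphi_{12}(r)),&(r,s)\in D^{(1)}_1\cup D^{(2)}_2,\\(a_4-a_1)(s-\varphi_{23}(r)),&(r,s)\in D^{(2)}_1\cup D^{(2)}_4,\\(a_2-a_1)(s-\varphi_{34}(r)),&(r,s)\in D^{(2)}_5\cup D^{(3)}_1,\\(a_2-a_3)(s-\varphi_{14}(r)),&(r,s)\in D^{(1)}_2\cup D^{(2)}_3\cup D^{(2)}_6\cup D^{(3)}_2,\\0,&\text{otherwise.}\end{cases}$$ Then the pair $(\langle A\rangle_\psi,\Delta_\psi A)$ has the joint probability density (with respect to Lebesgue measure on $\mathbb{R}^2$) $$f(r,x)=\frac{12}{V_4}\,x\,g(r,x^2+r^2)\quad(x\ge0),\qquad f(r,x)=0\quad(x<0).$$ Explicitly, $$f(r,x)=\frac{12}{V_4}\,x\begin{cases}(a_4-a_3)(x^2+r^2-\varphi_{12}(r)),&(r,x)\in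 R^{(1)}_1\cup R^{(2)}_2,\\(a_4-a_1)(x^2+r^2-\varphi_{23}(r)),&(r,x)\in R^{(2)}_1\cup R^{(2)}_4,\\(a_2-a_1)(x^2+r^2-\varphi_{34}(r)),&(r,x)\in R^{(2)}_5\cup R^{(3)}_1,\\(a_2-a_3)(x^2+r^2-\varphi_{14}(r)),&(r,x)\in R^{(1)}_2\cup R^{(2)}_3\cup R^{(2)}_6\cup R^{(3)}_2,\end{cases}$$ and $f(r,x)=0$ outside the union of the ten regions $R^{(i)}_j$. Moreover, with $\varepsilon_{ij}(x)=\sqrt{\left(\frac{a_i-a_j}{2}\right)^2-x^2}$ and with $\chi_S$ the indicator function of $S$ (a product $\chi_S\,\varepsilon_{ij}^3$ being $0$ outside $S$), $\Delta_\psi A$ has the probability density on $\mathbb{R}$ $$\begin{aligned}f_{\Delta A}(x)=\frac{16}{V_4}\,x\Big[&(a_4-a_3)\chi_{[0,\frac{a_2-a_1}2]}(x)\varepsilon_{12}^3(x)+(a_4-a_1)\chi_{[0,\frac{a_3-a_2}2]}(x)\varepsilon_{23}^3(x)-(a_4-a_2)\chi_{[0,\frac{a_3-a_1}2]}(x)\varepsilon_{13}^3(x)\\&+(a_2-a_1)\chi_{[0,\frac{a_4-a_3}2]}(x)\varepsilon_{34}^3(x)-(a_3-a_1)\chi_{[0,\frac{a_4-a_2}2]}(x)\varepsilon_{24}^3(x)+(a_3-a_2)\chi_{[0,\frac{a_4-a_1}2]}(x)\varepsilon_{14}^3(x)\Big].\end{aligned}$$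 -/

import Mathlib

open MeasureTheory

noncomputable section

namespace RandomState

/-- The unit vectors `ψ` of `ℂ⁴` (pure states). -/
abbrev PureState : Type := Metric.sphere (0 : EuclideanSpace ℂ (Fin 4)) 1

/-- The uniform (Haar) probability measure on the pure states of `ℂ⁴`: the surface measure of the
unit sphere of `ℂ⁴ = ℝ⁸`, divided by its total mass. -/
def uniformState : Measure PureState :=
  ((volume : Measure (EuclideanSpace ℂ (Fin 4))).toSphere Set.univ)⁻¹ •
    (volume : Measure (EuclideanSpace ℂ (Fin 4))).toSphere

instance : IsProbabilityMeasure uniformState := by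
  refine ⟨?_⟩
  have h0 : (volume : Measure (EuclideanSpace ℂ (Fin 4))).toSphere Set.univ ≠ 0 := by
    rw [Measure.toSphere_apply_univ]
    refine mul_ne_zero ?_ (Metric.measure_ball_pos volume _ one_pos).ne'
    exact_mod_cast (Module.finrank_pos (R := ℝ) (M := EuclideanSpace ℂ (Fin 4))).ne'
  simp only [uniformState, Measure.smul_apply, smul_eq_mul]
  exact ENNReal.inv_mul_cancel h0 (measure_ne_top _ _)

/-- The expectation value `⟨A⟩_ψ = ⟨ψ|A|ψ⟩` (it is real for Hermitian `A`). -/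
def expVal (A : Matrix (Fin 4) (Fin 4) ℂ) (ψ : PureState) : ℝ :=
  (inner ℂ (ψ : EuclideanSpace ℂ (Fin 4)) (Matrix.toEuclideanLin A ψ)).re

/-- The uncertainty (standard deviation) `Δ_ψ A = √(⟨A²⟩_ψ - ⟨A⟩_ψ²)`. -/
def uncertainty (A : Matrix (Fin 4) (Fin 4) ℂ) (ψ : PureState) : ℝ :=
  √(expVal (A ^ 2) ψ - expVal A ψ ^ 2)

/-- `f` is a probability density function of the random variable `X` under `μ`: `f` is measurable
and nonnegative, and the law of `X` has density `f` with respect to Lebesgue measure. -/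
def HasDensity {Ω E : Type*} [MeasurableSpace Ω] [MeasureSpace E]
    (μ : Measure Ω) (X : Ω → E) (f : E → ℝ) : Prop :=
  AEMeasurable X μ ∧ Measurable f ∧ (∀ y, 0 ≤ f y) ∧
    μ.map X = (volume : Measure E).withDensity (fun y => ENNReal.ofReal (f y))

/-! The eigenvalues are `a 0 < a 1 < a 2 < a 3` (indices start from `0`). In the names of the
regions the blocks and pieces are counted from `1`. -/

/-- The Vandermonde product `V₄(a) = ∏_{i<j} (a j - a i)`. -/
def V4 (a : Fin 4 → ℝ) : ℝ := ∏ i, ∏ j ∈ Finset.Ioi i, (a j - a i)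

/-- `φ_{ij}(r) = (a i + a j) r - a i a j`. -/
def phi (a : Fin 4 → ℝ) (i j : Fin 4) (r : ℝ) : ℝ := (a i + a j) * r - a i * a j

/-- The abscissa at which `φ_{02} = φ_{13}`. -/
def rMid (a : Fin 4 → ℝ) : ℝ := (a 1 * a 3 - a 0 * a 2) / (a 1 + a 3 - a 0 - a 2)

/-- `{(r, s) : lo ≤ r ≤ hi, φ_{ij}(r) ≤ s ≤ φ_{kl}(r)}`. -/
def regionD (a : Fin 4 → ℝ) (lo hi : ℝ) (i j k l : Fin 4) : Set (ℝ × ℝ) :=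
  {p | lo ≤ p.1 ∧ p.1 ≤ hi ∧ phi a i j p.1 ≤ p.2 ∧ p.2 ≤ phi a k l p.1}

/-- `{(r, x) : lo ≤ r ≤ hi, √((a j - r)(r - a i)) ≤ x ≤ √((a l - r)(r - a k))}`. -/
def regionR (a : Fin 4 → ℝ) (lo hi : ℝ) (i j k l : Fin 4) : Set (ℝ × ℝ) :=
  {p | lo ≤ p.1 ∧ p.1 ≤ hi ∧ √((a j - p.1) * (p.1 - a i)) ≤ p.2 ∧
    p.2 ≤ √((a l - p.1) * (p.1 - a k))}

def D11 (a : Fin 4 → ℝ) := regionD a (a 0) (a 1) 0 1 0 2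
def D12 (a : Fin 4 → ℝ) := regionD a (a 0) (a 1) 0 2 0 3
def D21 (a : Fin 4 → ℝ) := regionD a (a 1) (rMid a) 1 2 1 3
def D22 (a : Fin 4 → ℝ) := regionD a (a 1) (rMid a) 1 3 0 2
def D23 (a : Fin 4 → ℝ) := regionD a (a 1) (rMid a) 0 2 0 3
def D24 (a : Fin 4 → ℝ) := regionD a (rMid a) (a 2) 1 2 0 2
def D25 (a : Fin 4 → ℝ) := regionD a (rMid a) (a 2) 0 2 1 3
def D26 (a : Fin 4 → ℝ) := regionD a (rMid a) (a 2) 1 3 0 3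
def D31 (a : Fin 4 → ℝ) := regionD a (a 2) (a 3) 2 3 1 3
def D32 (a : Fin 4 → ℝ) := regionD a (a 2) (a 3) 1 3 0 3

def R11 (a : Fin 4 → ℝ) := regionR a (a 0) (a 1) 0 1 0 2
def R12 (a : Fin 4 → ℝ) := regionR a (a 0) (a 1) 0 2 0 3
def R21 (a : Fin 4 → ℝ) := regionR a (a 1) (rMid a) 1 2 1 3
def R22 (a : Fin 4 → ℝ) := regionR a (a 1) (rMid a) 1 3 0 2
def R23 (a : Fin 4 → ℝ) := regionR a (a 1) (rMid a) 0 2 0 3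
def R24 (a : Fin 4 → ℝ) := regionR a (rMid a) (a 2) 1 2 0 2
def R25 (a : Fin 4 → ℝ) := regionR a (rMid a) (a 2) 0 2 1 3
def R26 (a : Fin 4 → ℝ) := regionR a (rMid a) (a 2) 1 3 0 3
def R31 (a : Fin 4 → ℝ) := regionR a (a 2) (a 3) 2 3 1 3
def R32 (a : Fin 4 → ℝ) := regionR a (a 2) (a 3) 1 3 0 3

/-- The union `R` of the ten regions in the `(r, x)` plane. -/
def R (a : Fin 4 → ℝ) : Set (ℝ × ℝ) :=
  (R11 a ∪ R12 a) ∪ (R21 a ∪ R22 a ∪ R23 a ∪ R24 a ∪ R25 a ∪ R26 a) ∪ (R31 a ∪ R32 a)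

open Classical in
/-- The piecewise function `g(r, s)`, equal to `0` outside the union of the ten regions `Dᵢⱼ`.
The regions overlap in boundary points only, where the formulas agree. -/
def g (a : Fin 4 → ℝ) (r s : ℝ) : ℝ :=
  if (r, s) ∈ D11 a ∪ D22 a then (a 3 - a 2) * (s - phi a 0 1 r)
  else if (r, s) ∈ D21 a ∪ D24 a then (a 3 - a 0) * (s - phi a 1 2 r)
  else if (r, s) ∈ D25 a ∪ D31 a then (a 1 - a 0) * (s - phi a 2 3 r)
  else if (r, s) ∈ D12 a ∪ D23 a ∪ D26 a ∪ D32 a then (a 1 - a 2) * (s - phi a 0 3 r)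
  else 0

/-- The joint density `(12 / V₄) x g(r, x² + r²)` on `x ≥ 0`, extended by `0` to `x < 0`
(an uncertainty is never negative). -/
def jointDensity (a : Fin 4 → ℝ) (r x : ℝ) : ℝ :=
  if 0 ≤ x then 12 / V4 a * x * g a r (x ^ 2 + r ^ 2) else 0

/-- `ε_{ij}(x) = √(((a i - a j)/2)² - x²)`. -/
def eps (a : Fin 4 → ℝ) (i j : Fin 4) (x : ℝ) : ℝ := √(((a i - a j) / 2) ^ 2 - x ^ 2)

/-- `χ_{[0, (a j - a i)/2]}(x)`. -/
def chi (a : Fin 4 → ℝ) (i j : Fin 4) (x : ℝ) : ℝ :=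
  (Set.Icc 0 ((a j - a i) / 2)).indicator 1 x

/-- The density of the uncertainty. -/
def uncertaintyDensity (a : Fin 4 → ℝ) (x : ℝ) : ℝ :=
  16 / V4 a * x *
    ((a 3 - a 2) * chi a 0 1 x * eps a 0 1 x ^ 3
      + (a 3 - a 0) * chi a 1 2 x * eps a 1 2 x ^ 3
      - (a 3 - a 1) * chi a 0 2 x * eps a 0 2 x ^ 3
      + (a 1 - a 0) * chi a 2 3 x * eps a 2 3 x ^ 3
      - (a 2 - a 0) * chi a 1 3 x * eps a 1 3 x ^ 3
      + (a 2 - a 1) * chi a 0 3 x * eps a 0 3 x ^ 3)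

end RandomState

end

/-! In an eigenbasis of `A` only the weights `p i = |ψ i|²` matter. The uniform measure of a set of
states is the normalized volume of the cone over it, and `z ↦ |z i|²` carries Lebesgue measure of
`ℂ⁴` to `π⁴` times Lebesgue measure on the positive orthant. The Vandermonde matrix, of determinant
`V4 a`, turns weights into moments `(u, r, s, w)` of orders 0 to 3 (`volume_weights`). Positivity of
the weights confines `w` to an interval whose length at `u = 1` is the positive part of `minForm a r
s` (`volume_momentCone_slice`); integrating out the mass gives the law `(6 / V4) max 0 (minForm a r
s)` of the first two moments (`uniformState_moments`). The substitution `s = x² + r²`, `ds = 2x dx`,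
then yields the joint density, once `g` is recognized as that positive part (`g_eq_max_minForm`).

For the marginal, `max_minForm_eq_sum` rewrites `g` on `s ≥ r²` as a signed sum of positive parts of
`φ_{ij}(r) - s`. In `r` each is a truncated parabola, of integral `(4/3) ε_{ij}³`. -/

open scoped Pointwise

/-! ### The piecewise function `g` as the positive part of a minimum of four forms -/

namespace RandomState

/-- The smallest of the four linear forms occurring in `g`; it is the length of the set of third
moments compatible with the first two moments `r`, `s`. -/
noncomputable def minForm (a : Fin 4 → ℝ) (r s : ℝ) : ℝ :=
  min (min ((a 3 - a 2) * (s - phi a 0 1 r)) ((a 3 - a 0) * (s - phi a 1 2 r)))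
    (min ((a 1 - a 0) * (s - phi a 2 3 r)) ((a 1 - a 2) * (s - phi a 0 3 r)))

variable {a : Fin 4 → ℝ} {r s x : ℝ}

theorem strictMono_steps (ha : StrictMono a) : a 0 < a 1 ∧ a 1 < a 2 ∧ a 2 < a 3 :=
  ⟨ha (by decide), ha (by decide), ha (by decide)⟩

/-- Write `F_{ij}` for the form containing `φ_{ij}`. Then `F₁₂ - F₀₁ = F₂₃ - F₀₃ = (a 2 - a 0)(s -
φ₁₃)` and `F₀₁ - F₀₃ = F₁₂ - F₂₃ = (a 3 - a 1)(s - φ₀₂)`. So the signs of `s - φ₁₃` and `s - φ₀₂`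
alone select the minimum; their four combinations are this lemma and the next three. -/
theorem max_minForm_of_phi13_le_of_le_phi02 (ha : StrictMono a) (h01 : phi a 0 1 r ≤ s)
    (h13 : phi a 1 3 r ≤ s) (h02 : s ≤ phi a 0 2 r) :
    max 0 (minForm a r s) = (a 3 - a 2) * (s - phi a 0 1 r) := by
  obtain ⟨h1, h2, h3⟩ := strictMono_steps ha
  have h0 : 0 ≤ (a 3 - a 2) * (s - phi a 0 1 r) := mul_nonneg (by linarith) (by linarith)
  have e1 := mul_nonneg (by linarith : 0 ≤ a 2 - a 0) (sub_nonneg.2 h13)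
  have e2 := mul_nonneg (by linarith : 0 ≤ a 3 - a 1) (sub_nonneg.2 h02)
  simp only [phi, minForm] at *
  rw [min_eq_left (a := (a 3 - a 2) * _) (by linarith),
    min_eq_left (le_min (by linarith) (by linarith)), max_eq_right h0]

theorem max_minForm_of_le_phi13_of_le_phi02 (ha : StrictMono a) (h12 : phi a 1 2 r ≤ s)
    (h13 : s ≤ phi a 1 3 r) (h02 : s ≤ phi a 0 2 r) :
    max 0 (minForm a r s) = (a 3 - a 0) * (s - phi a 1 2 r) := by
  obtain ⟨h1, h2, h3⟩ := strictMono_steps ha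
  have h0 : 0 ≤ (a 3 - a 0) * (s - phi a 1 2 r) := mul_nonneg (by linarith) (by linarith)
  have e1 := mul_nonneg (by linarith : 0 ≤ a 2 - a 0) (sub_nonneg.2 h13)
  have e2 := mul_nonneg (by linarith : 0 ≤ a 3 - a 1) (sub_nonneg.2 h02)
  simp only [phi, minForm] at *
  rw [min_eq_right (a := (a 3 - a 2) * _) (by linarith),
    min_eq_left (le_min (by linarith) (by linarith)), max_eq_right h0]

theorem max_minForm_of_le_phi13_of_phi02_le (ha : StrictMono a) (h23 : phi a 2 3 r ≤ s)
    (h13 : s ≤ phi a 1 3 r) (h02 : phi a 0 2 r ≤ s) :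
    max 0 (minForm a r s) = (a 1 - a 0) * (s - phi a 2 3 r) := by
  obtain ⟨h1, h2, h3⟩ := strictMono_steps ha
  have h0 : 0 ≤ (a 1 - a 0) * (s - phi a 2 3 r) := mul_nonneg (by linarith) (by linarith)
  have e1 := mul_nonneg (by linarith : 0 ≤ a 2 - a 0) (sub_nonneg.2 h13)
  have e2 := mul_nonneg (by linarith : 0 ≤ a 3 - a 1) (sub_nonneg.2 h02)
  simp only [phi, minForm] at *
  rw [min_eq_left (a := (a 1 - a 0) * _) (by linarith),
    min_eq_right (le_min (by linarith) (by linarith)), max_eq_right h0]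

theorem max_minForm_of_phi13_le_of_phi02_le (ha : StrictMono a) (h03 : s ≤ phi a 0 3 r)
    (h13 : phi a 1 3 r ≤ s) (h02 : phi a 0 2 r ≤ s) :
    max 0 (minForm a r s) = (a 1 - a 2) * (s - phi a 0 3 r) := by
  obtain ⟨h1, h2, h3⟩ := strictMono_steps ha
  have h0 : 0 ≤ (a 1 - a 2) * (s - phi a 0 3 r) :=
    mul_nonneg_of_nonpos_of_nonpos (by linarith) (by linarith)
  have e1 := mul_nonneg (by linarith : 0 ≤ a 2 - a 0) (sub_nonneg.2 h13)
  have e2 := mul_nonneg (by linarith : 0 ≤ a 3 - a 1) (sub_nonneg.2 h02)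
  simp only [phi, minForm] at *
  rw [min_eq_right (a := (a 1 - a 0) * _) (by linarith),
    min_eq_right (le_min (by linarith) (by linarith)), max_eq_right h0]

theorem minForm_pos_iff (ha : StrictMono a) : 0 < minForm a r s ↔
    phi a 0 1 r < s ∧ phi a 1 2 r < s ∧ phi a 2 3 r < s ∧ s < phi a 0 3 r := by
  obtain ⟨h1, h2, h3⟩ := strictMono_steps ha
  have e : (a 1 - a 2) * (s - phi a 0 3 r) = (a 2 - a 1) * (phi a 0 3 r - s) := by ring
  rw [minForm, e, lt_min_iff, lt_min_iff, lt_min_iff, mul_pos_iff_of_pos_left (by linarith),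
    mul_pos_iff_of_pos_left (by linarith), mul_pos_iff_of_pos_left (by linarith),
    mul_pos_iff_of_pos_left (by linarith)]
  simp only [sub_pos, and_assoc]

/-- Decides the order of `φ₀₂` and `φ₁₃` from the side of `rMid a` on which `r` lies. -/
theorem phi02_sub_phi13 (ha : StrictMono a) (r : ℝ) :
    phi a 0 2 r - phi a 1 3 r = (a 1 + a 3 - a 0 - a 2) * (rMid a - r) := by
  obtain ⟨h1, h2, h3⟩ := strictMono_steps ha
  have : a 1 + a 3 - a 0 - a 2 ≠ 0 := by linarith
  simp only [phi, rMid]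
  field_simp
  ring

theorem phi_sub_sq (i j : Fin 4) : phi a i j r - r ^ 2 = (a j - r) * (r - a i) := by
  simp only [phi]; ring

/-- `rMid a` lies strictly between the two middle eigenvalues. -/
theorem rMid_mem (ha : StrictMono a) : a 1 < rMid a ∧ rMid a < a 2 := by
  obtain ⟨h1, h2, h3⟩ := strictMono_steps ha
  have h : 0 < a 1 + a 3 - a 0 - a 2 := by linarith
  rw [rMid, lt_div_iff₀ h, div_lt_iff₀ h]
  constructor
  · nlinarith [mul_pos (sub_pos.2 h1) (sub_pos.2 h2)]
  · nlinarith [mul_pos (sub_pos.2 h3) (sub_pos.2 h2)]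

section regions

variable (ha : StrictMono a)
include ha

theorem max_minForm_of_mem_D11_D22 (h : (r, s) ∈ D11 a ∪ D22 a) :
    max 0 (minForm a r s) = (a 3 - a 2) * (s - phi a 0 1 r) := by
  obtain ⟨h1, h2, h3⟩ := strictMono_steps ha
  rcases h with ⟨u, v, p, q⟩ | ⟨u, v, p, q⟩ <;> dsimp only at u v p q
  -- The product is `φ₀₁ - φ₁₃`, which changes sign at `r = a 1`. The analogous products below are
  -- likewise differences of two `φ`'s sharing an index.
  · have := mul_nonneg (sub_nonneg.2 v) (by linarith : 0 ≤ a 3 - a 0)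
    exact max_minForm_of_phi13_le_of_le_phi02 ha p (by simp only [phi] at *; linarith) q
  · have := mul_nonneg (sub_nonneg.2 u) (by linarith : 0 ≤ a 3 - a 0)
    exact max_minForm_of_phi13_le_of_le_phi02 ha (by simp only [phi] at *; linarith) p q

theorem max_minForm_of_mem_D21_D24 (h : (r, s) ∈ D21 a ∪ D24 a) :
    max 0 (minForm a r s) = (a 3 - a 0) * (s - phi a 1 2 r) := by
  obtain ⟨h1, h2, h3⟩ := strictMono_steps ha
  have e := phi02_sub_phi13 ha r
  rcases h with ⟨u, v, p, q⟩ | ⟨u, v, p, q⟩ <;> dsimp only at u v p q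
  · have := mul_nonneg (by linarith : 0 ≤ a 1 + a 3 - a 0 - a 2) (sub_nonneg.2 v)
    exact max_minForm_of_le_phi13_of_le_phi02 ha p q (by linarith)
  · have := mul_nonneg (by linarith : 0 ≤ a 1 + a 3 - a 0 - a 2) (sub_nonneg.2 u)
    exact max_minForm_of_le_phi13_of_le_phi02 ha p (by linarith) q

theorem max_minForm_of_mem_D25_D31 (h : (r, s) ∈ D25 a ∪ D31 a) :
    max 0 (minForm a r s) = (a 1 - a 0) * (s - phi a 2 3 r) := by
  obtain ⟨h1, h2, h3⟩ := strictMono_steps ha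
  rcases h with ⟨u, v, p, q⟩ | ⟨u, v, p, q⟩ <;> dsimp only at u v p q
  · have := mul_nonneg (sub_nonneg.2 v) (by linarith : 0 ≤ a 3 - a 0)
    exact max_minForm_of_le_phi13_of_phi02_le ha (by simp only [phi] at *; linarith) q p
  · have := mul_nonneg (sub_nonneg.2 u) (by linarith : 0 ≤ a 3 - a 0)
    exact max_minForm_of_le_phi13_of_phi02_le ha p q (by simp only [phi] at *; linarith)

theorem max_minForm_of_mem_D12_D23_D26_D32 (h : (r, s) ∈ D12 a ∪ D23 a ∪ D26 a ∪ D32 a) :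
    max 0 (minForm a r s) = (a 1 - a 2) * (s - phi a 0 3 r) := by
  obtain ⟨h1, h2, h3⟩ := strictMono_steps ha
  have e := phi02_sub_phi13 ha r
  rcases h with ((⟨u, v, p, q⟩ | ⟨u, v, p, q⟩) | ⟨u, v, p, q⟩) | ⟨u, v, p, q⟩ <;>
    dsimp only at u v p q
  · have e1 := mul_nonneg (sub_nonneg.2 v) (by linarith : 0 ≤ a 3 - a 0)
    have e2 := mul_nonneg (sub_nonneg.2 u) (by linarith : 0 ≤ a 2 - a 1)
    exact max_minForm_of_phi13_le_of_phi02_le ha q (by simp only [phi] at *; linarith) p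
  · have := mul_nonneg (by linarith : 0 ≤ a 1 + a 3 - a 0 - a 2) (sub_nonneg.2 v)
    exact max_minForm_of_phi13_le_of_phi02_le ha q (by linarith) p
  · have := mul_nonneg (by linarith : 0 ≤ a 1 + a 3 - a 0 - a 2) (sub_nonneg.2 u)
    exact max_minForm_of_phi13_le_of_phi02_le ha q p (by linarith)
  · have e1 := mul_nonneg (sub_nonneg.2 u) (by linarith : 0 ≤ a 3 - a 0)
    have e2 := mul_nonneg (sub_nonneg.2 v) (by linarith : 0 ≤ a 2 - a 1)
    exact max_minForm_of_phi13_le_of_phi02_le ha q p (by simp only [phi] at *; linarith)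

theorem mem_regions_of_minForm_pos (h : 0 < minForm a r s) :
    (r, s) ∈ D11 a ∪ D22 a ∨ (r, s) ∈ D21 a ∪ D24 a ∨ (r, s) ∈ D25 a ∪ D31 a ∨
      (r, s) ∈ D12 a ∪ D23 a ∪ D26 a ∪ D32 a := by
  obtain ⟨h1, h2, h3⟩ := strictMono_steps ha
  obtain ⟨p01, p12, p23, p03⟩ := (minForm_pos_iff ha).1 h
  -- `φ₀₃ - φ₀₁ = (a 3 - a 1)(r - a 0)` must be positive; for the upper bound, `φ₀₃ - φ₂₃ = (a 2 - a
  -- 0)(a 3 - r)`.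
  have r0 : a 0 ≤ r := by
    by_contra! hr
    have := mul_pos (sub_pos.2 hr) (by linarith : 0 < a 3 - a 1)
    simp only [phi] at *; linarith
  have r3 : r ≤ a 3 := by
    by_contra! hr
    have := mul_pos (sub_pos.2 hr) (by linarith : 0 < a 2 - a 0)
    simp only [phi] at *; linarith
  rcases le_total r (a 1) with r1 | r1
  · rcases le_total s (phi a 0 2 r) with k | k
    · exact .inl (.inl ⟨r0, r1, p01.le, k⟩)
    · exact .inr (.inr (.inr (.inl (.inl (.inl ⟨r0, r1, k, p03.le⟩)))))
  rcases le_total (a 2) r with r2 | r2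
  · rcases le_total s (phi a 1 3 r) with k | k
    · exact .inr (.inr (.inl (.inr ⟨r2, r3, p23.le, k⟩)))
    · exact .inr (.inr (.inr (.inr ⟨r2, r3, k, p03.le⟩)))
  rcases le_total r (rMid a) with m | m <;> rcases le_total s (phi a 0 2 r) with k | k <;>
    rcases le_total s (phi a 1 3 r) with k' | k'
  · exact .inr (.inl (.inl ⟨r1, m, p12.le, k'⟩))
  · exact .inl (.inr ⟨r1, m, k', k⟩)
  · exact .inr (.inr (.inr (.inl (.inl (.inr ⟨r1, m, k, p03.le⟩)))))
  · exact .inr (.inr (.inr (.inl (.inl (.inr ⟨r1, m, k, p03.le⟩)))))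
  · exact .inr (.inl (.inr ⟨m, r2, p12.le, k⟩))
  · exact .inr (.inr (.inr (.inl (.inr ⟨m, r2, k', p03.le⟩))))
  · exact .inr (.inr (.inl (.inl ⟨m, r2, k, k'⟩)))
  · exact .inr (.inr (.inr (.inl (.inr ⟨m, r2, k', p03.le⟩))))

theorem g_eq_max_minForm (r s : ℝ) : g a r s = max 0 (minForm a r s) := by
  unfold g
  split_ifs with k1 k2 k3 k4
  · exact (max_minForm_of_mem_D11_D22 ha k1).symm
  · exact (max_minForm_of_mem_D21_D24 ha k2).symm
  · exact (max_minForm_of_mem_D25_D31 ha k3).symm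
  · exact (max_minForm_of_mem_D12_D23_D26_D32 ha k4).symm
  · rw [max_eq_left]
    by_contra! hc
    have := mem_regions_of_minForm_pos ha hc
    tauto

theorem minForm_le_zero (h : s ≤ phi a 0 1 r ∨ s ≤ phi a 1 2 r ∨ s ≤ phi a 2 3 r ∨
    phi a 0 3 r ≤ s) : minForm a r s ≤ 0 := by
  by_contra! hc
  obtain ⟨p01, p12, p23, p03⟩ := (minForm_pos_iff ha).1 hc
  rcases h with h | h | h | h <;> linarith

omit ha in
theorem phi_le_sq_left {i j : Fin 4} (hi : r ≤ a i) (hj : r ≤ a j) : phi a i j r ≤ r ^ 2 := by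
  have := phi_sub_sq (a := a) (r := r) i j
  have := mul_nonneg (sub_nonneg.2 hi) (sub_nonneg.2 hj)
  linarith

omit ha in
theorem phi_le_sq_right {i j : Fin 4} (hi : a i ≤ r) (hj : a j ≤ r) : phi a i j r ≤ r ^ 2 := by
  have := phi_sub_sq (a := a) (r := r) i j
  have := mul_nonneg (sub_nonneg.2 hi) (sub_nonneg.2 hj)
  linarith

/-- On `s ≥ r²` the function `g` is a combination of the positive parts of `φ_{ij}(r) - s`. -/
theorem max_minForm_eq_sum (hs : r ^ 2 ≤ s) : max 0 (minForm a r s) =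
    (a 3 - a 2) * max 0 (phi a 0 1 r - s) + (a 3 - a 0) * max 0 (phi a 1 2 r - s)
      - (a 3 - a 1) * max 0 (phi a 0 2 r - s) + (a 1 - a 0) * max 0 (phi a 2 3 r - s)
      - (a 2 - a 0) * max 0 (phi a 1 3 r - s) + (a 2 - a 1) * max 0 (phi a 0 3 r - s) := by
  obtain ⟨h1, h2, h3⟩ := strictMono_steps ha
  have z : ∀ {y}, y ≤ s → max 0 (y - s) = 0 := fun h => max_eq_left (by linarith)
  have w : ∀ {y}, s ≤ y → max 0 (y - s) = y - s := fun h => max_eq_right (by linarith)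
  -- Since `φ_{ij}(r) - r² = (a j - r)(r - a i)`, only pairs whose eigenvalues enclose `r`
  -- contribute when `s ≥ r²`.
  have lz : ∀ {i j : Fin 4}, r ≤ a i → r ≤ a j → max 0 (phi a i j r - s) = 0 :=
    fun hi hj => z ((phi_le_sq_left hi hj).trans hs)
  have rz : ∀ {i j : Fin 4}, a i ≤ r → a j ≤ r → max 0 (phi a i j r - s) = 0 :=
    fun hi hj => z ((phi_le_sq_right hi hj).trans hs)
  rcases le_total r (a 0) with r0 | r0
  · rw [lz, lz, lz, lz, lz, lz, max_eq_left (minForm_le_zero ha (.inr (.inr (.inr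
      ((phi_le_sq_left (by linarith) (by linarith)).trans hs)))))]
    · ring
    all_goals linarith
  rcases le_total r (a 1) with r1 | r1
  · rw [lz (i := 1) (j := 2) (by linarith) (by linarith),
      lz (i := 2) (j := 3) (by linarith) (by linarith),
      lz (i := 1) (j := 3) (by linarith) (by linarith)]
    have e13 := (phi_le_sq_left r1 (by linarith : r ≤ a 3)).trans hs
    have e12 : phi a 0 1 r ≤ phi a 0 2 r := by
      have := mul_nonneg (sub_nonneg.2 r0) (sub_nonneg.2 h2.le)
      simp only [phi]; linarith
    have e23 : phi a 0 2 r ≤ phi a 0 3 r := by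
      have := mul_nonneg (sub_nonneg.2 r0) (sub_nonneg.2 h3.le)
      simp only [phi]; linarith
    rcases le_total s (phi a 0 1 r) with k1 | k1
    -- The three remaining terms cancel: `φ_{0j}(r)` is affine in `a j`, and the coefficients `a 3 -
    -- a 2`, `-(a 3 - a 1)`, `a 2 - a 1` annihilate affine functions at `a 1`, `a 2`, `a 3`.
    · rw [max_eq_left (minForm_le_zero ha (.inl k1)), w k1, w (by linarith), w (by linarith)]
      simp only [phi]; ring
    rcases le_total s (phi a 0 2 r) with k2 | k2
    · rw [max_minForm_of_phi13_le_of_le_phi02 ha k1 e13 k2, z k1, w k2, w (by linarith)]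
      simp only [phi]; ring
    rcases le_total s (phi a 0 3 r) with k3 | k3
    · rw [max_minForm_of_phi13_le_of_phi02_le ha k3 e13 k2, z k1, z k2, w k3]
      simp only [phi]; ring
    · rw [max_eq_left (minForm_le_zero ha (.inr (.inr (.inr k3)))), z k1, z k2, z k3]
      ring
  rcases le_total r (a 2) with r2 | r2
  · rw [rz (i := 0) (j := 1) (by linarith) (by linarith),
      lz (i := 2) (j := 3) (by linarith) (by linarith)]
    have e01 := (phi_le_sq_right r0 r1).trans hs
    have e23 := (phi_le_sq_left r2 (by linarith : r ≤ a 3)).trans hs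
    have f1 : phi a 1 2 r ≤ phi a 0 2 r := by
      have := mul_nonneg (sub_nonneg.2 r2) (sub_nonneg.2 h1.le)
      simp only [phi]; linarith
    have f2 : phi a 1 2 r ≤ phi a 1 3 r := by
      have := mul_nonneg (sub_nonneg.2 r1) (sub_nonneg.2 h3.le)
      simp only [phi]; linarith
    have f3 : phi a 0 2 r ≤ phi a 0 3 r := by
      have := mul_nonneg (sub_nonneg.2 r0) (sub_nonneg.2 h3.le)
      simp only [phi]; linarith
    have f4 : phi a 1 3 r ≤ phi a 0 3 r := by
      have := mul_nonneg (sub_nonneg.2 (r2.trans h3.le)) (sub_nonneg.2 h1.le)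
      simp only [phi]; linarith
    rcases le_total s (phi a 1 2 r) with k1 | k1
    · rw [max_eq_left (minForm_le_zero ha (.inr (.inl k1))), w k1, w (by linarith),
        w (by linarith), w (by linarith)]
      simp only [phi]; ring
    rcases le_total (phi a 0 3 r) s with k3 | k3
    · rw [max_eq_left (minForm_le_zero ha (.inr (.inr (.inr k3)))), z k1, z (by linarith),
        z (by linarith), z k3]
      ring
    rw [z k1, w k3]
    rcases le_total s (phi a 0 2 r) with k2 | k2 <;> rcases le_total s (phi a 1 3 r) with k4 | k4
    · rw [max_minForm_of_le_phi13_of_le_phi02 ha k1 k4 k2, w k2, w k4]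
      simp only [phi]; ring
    · rw [max_minForm_of_phi13_le_of_le_phi02 ha e01 k4 k2, w k2, z k4]
      simp only [phi]; ring
    · rw [max_minForm_of_le_phi13_of_phi02_le ha e23 k4 k2, z k2, w k4]
      simp only [phi]; ring
    · rw [max_minForm_of_phi13_le_of_phi02_le ha k3 k4 k2, z k2, z k4]
      simp only [phi]; ring
  rcases le_total r (a 3) with r3 | r3
  · rw [rz (i := 0) (j := 1) (by linarith) (by linarith),
      rz (i := 1) (j := 2) (by linarith) (by linarith),
      rz (i := 0) (j := 2) (by linarith) (by linarith)]
    have e02 := (phi_le_sq_right r0 r2).trans hs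
    have f1 : phi a 2 3 r ≤ phi a 1 3 r := by
      have := mul_nonneg (sub_nonneg.2 r3) (sub_nonneg.2 h2.le)
      simp only [phi]; linarith
    have f2 : phi a 1 3 r ≤ phi a 0 3 r := by
      have := mul_nonneg (sub_nonneg.2 r3) (sub_nonneg.2 h1.le)
      simp only [phi]; linarith
    rcases le_total s (phi a 2 3 r) with k1 | k1
    · rw [max_eq_left (minForm_le_zero ha (.inr (.inr (.inl k1)))), w k1, w (by linarith),
        w (by linarith)]
      simp only [phi]; ring
    rcases le_total s (phi a 1 3 r) with k2 | k2
    · rw [max_minForm_of_le_phi13_of_phi02_le ha k1 k2 e02, z k1, w k2, w (by linarith)]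
      simp only [phi]; ring
    rcases le_total s (phi a 0 3 r) with k3 | k3
    · rw [max_minForm_of_phi13_le_of_phi02_le ha k3 k2 e02, z k1, z k2, w k3]
      simp only [phi]; ring
    · rw [max_eq_left (minForm_le_zero ha (.inr (.inr (.inr k3)))), z k1, z k2, z k3]
      ring
  · rw [rz, rz, rz, rz, rz, rz, max_eq_left (minForm_le_zero ha (.inr (.inr (.inr
      ((phi_le_sq_right r0 r3).trans hs)))))]
    · ring
    all_goals linarith

theorem V4_pos : 0 < V4 a :=
  Finset.prod_pos fun _ _ => Finset.prod_pos fun _ hj => sub_pos.2 (ha (Finset.mem_Ioi.1 hj))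

theorem jointDensity_eq (r x : ℝ) : jointDensity a r x =
    if 0 ≤ x then 12 / V4 a * x * max 0 (minForm a r (x ^ 2 + r ^ 2)) else 0 := by
  rw [jointDensity, g_eq_max_minForm ha]

theorem jointDensity_nonneg (r x : ℝ) : 0 ≤ jointDensity a r x := by
  have := V4_pos ha
  rw [jointDensity_eq ha]
  split_ifs <;> positivity

theorem measurable_jointDensity : Measurable fun p : ℝ × ℝ => jointDensity a p.1 p.2 := by
  simp only [jointDensity_eq ha, minForm, phi]
  refine Measurable.ite (measurableSet_le measurable_const measurable_snd) ?_ measurable_const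
  exact Continuous.measurable (by fun_prop)

end regions

/-- Squaring is harmless for the lower bound, as `0 ≤ x`. The upper radicand must be nonnegative,
since otherwise `√` returns `0` and the point `x = 0` could satisfy the bound wrongly; `hkl` ensures
this. -/
theorem regionR_iff {lo hi : ℝ} {i j k l : Fin 4}
    (hkl : ∀ r, lo ≤ r → r ≤ hi → a k ≤ r ∧ r ≤ a l) :
    (r, x) ∈ regionR a lo hi i j k l ↔ 0 ≤ x ∧ (r, x ^ 2 + r ^ 2) ∈ regionD a lo hi i j k l := by
  simp only [regionR, regionD, Set.mem_ofPred_eq]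
  by_cases hr : lo ≤ r ∧ r ≤ hi
  · obtain ⟨h1, h2⟩ := hr
    have p1 := phi_sub_sq (a := a) (r := r) i j
    have p2 := phi_sub_sq (a := a) (r := r) k l
    have n2 := mul_nonneg (sub_nonneg.2 (hkl r h1 h2).2) (sub_nonneg.2 (hkl r h1 h2).1)
    simp only [h1, h2, true_and]
    constructor
    · rintro ⟨u, v⟩
      have hx : 0 ≤ x := (Real.sqrt_nonneg _).trans u
      rw [Real.sqrt_le_left hx] at u
      rw [Real.le_sqrt hx n2] at v
      exact ⟨hx, by linarith, by linarith⟩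
    · rintro ⟨hx, u, v⟩
      rw [Real.sqrt_le_left hx, Real.le_sqrt hx n2]
      exact ⟨by linarith, by linarith⟩
  · tauto

theorem jointDensity_of_max_minForm (ha : StrictMono a) {c : ℝ} (hx : 0 ≤ x)
    (h : max 0 (minForm a r (x ^ 2 + r ^ 2)) = c) :
    jointDensity a r x = 12 / V4 a * x * c := by
  rw [jointDensity_eq ha, if_pos hx, h]

end RandomState

/-! ### From the sphere of `ℂ⁴` to Lebesgue measure on the weights -/

namespace RandomState

/-- Serves twice: for the squared modulus in polar coordinates, and for the passage from variance to
uncertainty. -/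
theorem lintegral_Ioi_comp_sq (f : ℝ → ENNReal) :
    ∫⁻ y in Set.Ioi (0 : ℝ), f y = ∫⁻ x in Set.Ioi (0 : ℝ), ENNReal.ofReal (2 * x) * f (x ^ 2) := by
  have himg : (fun x : ℝ => x ^ 2) '' Set.Ioi 0 = Set.Ioi 0 := by
    ext y
    constructor
    · rintro ⟨x, hx, rfl⟩
      exact pow_pos (Set.mem_Ioi.1 hx) 2
    · intro hy
      exact ⟨√y, Real.sqrt_pos.2 hy, Real.sq_sqrt (le_of_lt hy)⟩
  have h := lintegral_image_eq_lintegral_abs_deriv_mul (f := fun x : ℝ => x ^ 2)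
    (f' := fun x => 2 * x) (s := Set.Ioi 0) measurableSet_Ioi
    (fun x _ => by simpa using (hasDerivAt_pow 2 x).hasDerivWithinAt)
    (fun x hx y hy hxy => (sq_eq_sq₀ (le_of_lt hx) (le_of_lt hy)).1 hxy) f
  rw [himg] at h
  rw [h]
  refine setLIntegral_congr_fun measurableSet_Ioi fun x hx => ?_
  rw [abs_of_pos (mul_pos two_pos hx)]

/-- The squared modulus maps the area measure of `ℂ` to `π` times Lebesgue measure on `(0, ∞)`. -/
theorem map_norm_sq_volume : (volume : Measure ℂ).map (fun z => ‖z‖ ^ 2) =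
    ENNReal.ofReal Real.pi • (volume : Measure ℝ).restrict (Set.Ioi 0) := by
  have hm : Measurable fun z : ℂ => ‖z‖ ^ 2 := by fun_prop
  ext s hs
  have hi : Measurable (s.indicator (1 : ℝ → ENNReal)) := measurable_one.indicator hs
  rw [Measure.map_apply hm hs, Measure.smul_apply, smul_eq_mul,
    ← lintegral_indicator_one (hm hs), ← lintegral_indicator_one hs, lintegral_Ioi_comp_sq,
    ← Complex.lintegral_comp_polarCoord_symm, polarCoord_target]
  have : ∀ p ∈ Set.Ioi (0 : ℝ) ×ˢ Set.Ioo (-Real.pi) Real.pi,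
      ENNReal.ofReal p.1 • ((fun z : ℂ => ‖z‖ ^ 2) ⁻¹' s).indicator (1 : ℂ → ENNReal)
        (Complex.polarCoord.symm p) = ENNReal.ofReal p.1 * s.indicator 1 (p.1 ^ 2) := by
    intro p hp
    rw [smul_eq_mul]
    have hn : ‖Complex.polarCoord.symm p‖ ^ 2 = p.1 ^ 2 := by
      rw [Complex.norm_polarCoord_symm, sq_abs]
    rw [← hn]
    rfl
  rw [setLIntegral_congr_fun (measurableSet_Ioi.prod measurableSet_Ioo) this, Measure.volume_eq_prod,
    ← Measure.prod_restrict, lintegral_prod _ (by fun_prop)]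
  simp only [lintegral_const, Measure.restrict_apply_univ, Real.volume_Ioo]
  rw [← lintegral_const_mul _ (by fun_prop)]
  refine lintegral_congr fun x => ?_
  rw [ENNReal.ofReal_mul zero_le_two, show Real.pi - -Real.pi = Real.pi * 2 by ring,
    ENNReal.ofReal_mul Real.pi_pos.le]
  ring

theorem map_norm_sq_volume_pi (n : ℕ) :
    (volume : Measure (Fin n → ℂ)).map (fun z i => ‖z i‖ ^ 2) =
      ENNReal.ofReal (Real.pi ^ n) •
        (volume : Measure (Fin n → ℝ)).restrict (Set.univ.pi fun _ => Set.Ioi 0) := by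
  have hσ : SigmaFinite ((volume : Measure ℂ).map fun z => ‖z‖ ^ 2) := by
    rw [map_norm_sq_volume]
    exact inferInstanceAs (SigmaFinite (Real.toNNReal Real.pi • (volume.restrict (Set.Ioi (0 : ℝ)))))
  rw [volume_pi, Measure.pi_map_pi (hμ := fun _ => hσ) fun _ => by fun_prop]
  have := fun _ : Fin n => hσ
  refine Measure.pi_eq fun s hs => ?_
  rw [map_norm_sq_volume]
  simp only [Measure.smul_apply, smul_eq_mul]
  rw [Finset.prod_mul_distrib, Finset.prod_const, Finset.card_univ, Fintype.card_fin,
    ENNReal.ofReal_pow Real.pi_pos.le, volume_pi, Measure.restrict_pi_pi, Measure.pi_pi]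

/-- The surface measure is the dimension times the volume of the cone, so the probability is a ratio
cone/ball. Any two Haar measures are proportional, and the factor `c` cancels from the ratio; the
unit ball has volume `π⁴/4!` in the coordinates `Fin 4 → ℂ`. -/
theorem uniformState_apply_of_cone (e : EuclideanSpace ℂ (Fin 4) ≃L[ℝ] (Fin 4 → ℂ))
    (he : ∀ z, ∑ i, ‖e z i‖ ^ 2 = ‖z‖ ^ 2) {S : Set PureState} (hS : MeasurableSet S)
    {T : Set (Fin 4 → ℂ)} (hT : MeasurableSet T)
    (h : Set.Ioo (0 : ℝ) 1 • (Subtype.val '' S) = e ⁻¹' T) :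
    uniformState S = ENNReal.ofReal (24 / Real.pi ^ 4) * volume T := by
  have hHaar : (Measure.map e volume).IsAddHaarMeasure := e.isAddHaarMeasure_map volume
  have hme : Measurable e := e.continuous.measurable
  obtain ⟨c, hc⟩ : ∃ c : NNReal, Measure.map e volume = c • volume :=
    ⟨_, Measure.isAddLeftInvariant_eq_smul _ _⟩
  have hc0 : c ≠ 0 := by
    rintro rfl
    have := (Measure.map e volume).measure_univ_ne_zero.2 (NeZero.ne _)
    simp [hc] at this
  have hball : MeasurableSet {x : Fin 4 → ℂ | ∑ i, ‖x i‖ ^ (2 : ℝ) < 1} :=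
    measurableSet_lt (by fun_prop) measurable_const
  have hb : Metric.ball (0 : EuclideanSpace ℂ (Fin 4)) 1 =
      e ⁻¹' {x | ∑ i, ‖x i‖ ^ (2 : ℝ) < 1} := by
    ext z
    simp only [Metric.mem_ball, dist_zero_right, Set.mem_preimage, Set.mem_ofPred_eq,
      Real.rpow_two, he]
    rw [sq_lt_one_iff₀ (norm_nonneg _)]
  have hv : volume {x : Fin 4 → ℂ | ∑ i, ‖x i‖ ^ (2 : ℝ) < 1} =
      ENNReal.ofReal (Real.pi ^ 4 / 24) := by
    rw [Complex.volume_sum_rpow_lt_one _ one_le_two]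
    congr 1
    have h5 : Real.Gamma (2 * (Fintype.card (Fin 4) : ℝ) / 2 + 1) = 24 := by
      rw [Fintype.card_fin, show (2 * ((4 : ℕ) : ℝ) / 2 + 1) = ((4 : ℕ) : ℝ) + 1 by norm_num,
        Real.Gamma_nat_eq_factorial]
      norm_num [Nat.factorial]
    have h2 : Real.Gamma (2 / 2 + 1) = 1 := by norm_num
    rw [h5, h2, Fintype.card_fin, mul_one]
  rw [uniformState, Measure.smul_apply, Measure.toSphere_apply' _ hS, Measure.toSphere_apply_univ,
    h, hb, ← Measure.map_apply hme hT, ← Measure.map_apply hme hball, hc]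
  simp only [Measure.smul_apply, hv, smul_eq_mul, ENNReal.smul_def]
  have hd : (Module.finrank ℝ (EuclideanSpace ℂ (Fin 4)) : ENNReal) ≠ 0 :=
    Nat.cast_ne_zero.2 Module.finrank_pos.ne'
  have hc' : (c : ENNReal) ≠ 0 := ENNReal.coe_ne_zero.2 hc0
  rw [← inv_div (Real.pi ^ 4) 24, ENNReal.ofReal_inv_of_pos (by positivity), ← ENNReal.div_eq_inv_mul,
    ← ENNReal.div_eq_inv_mul, ENNReal.mul_div_mul_left _ _ hd (ENNReal.natCast_ne_top _),
    ENNReal.mul_div_mul_left _ _ hc' ENNReal.coe_ne_top]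

end RandomState

/-! ### Moments of positive weights on four points -/

namespace RandomState

variable {a : Fin 4 → ℝ}

/-- The nesting lets Fubini first fix the mass `u`, then the pair `(r, s)`, leaving `w` as the
innermost variable. -/
theorem volume_preserving_vecCons :
    MeasurePreserving (fun q : ℝ × ((ℝ × ℝ) × ℝ) => ![q.1, q.2.1.1, q.2.1.2, q.2.2]) := by
  have hm : Measurable (fun q : ℝ × ((ℝ × ℝ) × ℝ) => ![q.1, q.2.1.1, q.2.1.2, q.2.2]) := by
    refine measurable_pi_lambda _ fun i => ?_
    fin_cases i <;> simp <;> fun_prop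
  refine ⟨hm, (Measure.pi_eq fun s hs => ?_).symm⟩
  rw [Measure.map_apply hm (MeasurableSet.univ_pi hs)]
  have : (fun q : ℝ × ((ℝ × ℝ) × ℝ) => ![q.1, q.2.1.1, q.2.1.2, q.2.2]) ⁻¹' Set.univ.pi s =
      s 0 ×ˢ ((s 1 ×ˢ s 2) ×ˢ s 3) := by
    ext q
    simp [Fin.forall_fin_succ, and_assoc]
  rw [this]
  simp only [Measure.volume_eq_prod, Measure.prod_prod, Fin.prod_univ_four, mul_assoc]

/-- The third moment of a weight of mass `u` and first moments `r`, `s` carried by the three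
points `a i`, `a j`, `a k`. -/
def thirdMoment (a : Fin 4 → ℝ) (i j k : Fin 4) (u r s : ℝ) : ℝ :=
  (a i + a j + a k) * s - (a i * a j + a i * a k + a j * a k) * r + a i * a j * a k * u

/-- The moment sequences `(u, r, s, w)` of positive weights on the four points `a i`. -/
def momentCone (a : Fin 4 → ℝ) (u r s w : ℝ) : Prop :=
  thirdMoment a 0 2 3 u r s < w ∧ thirdMoment a 0 1 2 u r s < w ∧
    w < thirdMoment a 1 2 3 u r s ∧ w < thirdMoment a 0 1 3 u r s

/-- `w - thirdMoment a i j k u r s` is the sum of `(a l - a i)(a l - a j)(a l - a k) p l` over `l`.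
Only the index outside the triple survives, so each inequality is the positivity of one weight, its
direction given by the sign of the product. -/
theorem momentCone_iff (ha : StrictMono a) (p : Fin 4 → ℝ) :
    momentCone a (∑ i, p i) (∑ i, a i * p i) (∑ i, a i ^ 2 * p i) (∑ i, a i ^ 3 * p i) ↔
      ∀ i, 0 < p i := by
  obtain ⟨h1, h2, h3⟩ := strictMono_steps ha
  have c0 : 0 < (a 1 - a 0) * (a 2 - a 0) * (a 3 - a 0) :=
    mul_pos (mul_pos (by linarith) (by linarith)) (by linarith)
  have c1 : 0 < (a 1 - a 0) * (a 2 - a 1) * (a 3 - a 1) :=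
    mul_pos (mul_pos (by linarith) (by linarith)) (by linarith)
  have c2 : 0 < (a 2 - a 0) * (a 2 - a 1) * (a 3 - a 2) :=
    mul_pos (mul_pos (by linarith) (by linarith)) (by linarith)
  have c3 : 0 < (a 3 - a 0) * (a 3 - a 1) * (a 3 - a 2) :=
    mul_pos (mul_pos (by linarith) (by linarith)) (by linarith)
  rw [Fin.forall_fin_succ, Fin.forall_fin_succ, Fin.forall_fin_succ, Fin.forall_fin_succ]
  simp only [IsEmpty.forall_iff, and_true]
  change _ ↔ 0 < p 0 ∧ 0 < p 1 ∧ 0 < p 2 ∧ 0 < p 3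
  rw [← mul_pos_iff_of_pos_left c0, ← mul_pos_iff_of_pos_left (b := p 1) c1,
    ← mul_pos_iff_of_pos_left (b := p 2) c2, ← mul_pos_iff_of_pos_left (b := p 3) c3]
  have e0 : thirdMoment a 1 2 3 (∑ i, p i) (∑ i, a i * p i) (∑ i, a i ^ 2 * p i) -
      ∑ i, a i ^ 3 * p i = (a 1 - a 0) * (a 2 - a 0) * (a 3 - a 0) * p 0 := by
    simp only [thirdMoment, Fin.sum_univ_four]; ring
  have e1 : ∑ i, a i ^ 3 * p i - thirdMoment a 0 2 3 (∑ i, p i) (∑ i, a i * p i)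
      (∑ i, a i ^ 2 * p i) = (a 1 - a 0) * (a 2 - a 1) * (a 3 - a 1) * p 1 := by
    simp only [thirdMoment, Fin.sum_univ_four]; ring
  have e2 : thirdMoment a 0 1 3 (∑ i, p i) (∑ i, a i * p i) (∑ i, a i ^ 2 * p i) -
      ∑ i, a i ^ 3 * p i = (a 2 - a 0) * (a 2 - a 1) * (a 3 - a 2) * p 2 := by
    simp only [thirdMoment, Fin.sum_univ_four]; ring
  have e3 : ∑ i, a i ^ 3 * p i - thirdMoment a 0 1 2 (∑ i, p i) (∑ i, a i * p i)
      (∑ i, a i ^ 2 * p i) = (a 3 - a 0) * (a 3 - a 1) * (a 3 - a 2) * p 3 := by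
    simp only [thirdMoment, Fin.sum_univ_four]; ring
  rw [← e0, ← e1, ← e2, ← e3, sub_pos, sub_pos, sub_pos, sub_pos]
  unfold momentCone
  tauto

theorem momentCone_smul {u : ℝ} (hu : 0 < u) (r s w : ℝ) :
    momentCone a 1 (u⁻¹ * r) (u⁻¹ * s) (u⁻¹ * w) ↔ momentCone a u r s w := by
  have e : ∀ i j k, thirdMoment a i j k 1 (u⁻¹ * r) (u⁻¹ * s) =
      u⁻¹ * thirdMoment a i j k u r s := by
    intro i j k
    simp only [thirdMoment]
    field_simp
  simp only [momentCone, e, mul_lt_mul_iff_right₀ (inv_pos.2 hu)]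

/-- The interval has two lower and two upper bounds; its length is the least of the four
differences, which are the four forms. `ENNReal.ofReal` covers the empty case. -/
theorem volume_momentCone_slice (r s : ℝ) :
    volume {w | momentCone a 1 r s w} = ENNReal.ofReal (minForm a r s) := by
  have : {w | momentCone a 1 r s w} = Set.Ioo
      (max (thirdMoment a 0 2 3 1 r s) (thirdMoment a 0 1 2 1 r s))
      (min (thirdMoment a 1 2 3 1 r s) (thirdMoment a 0 1 3 1 r s)) := by
    ext w
    simp only [momentCone, Set.mem_ofPred_eq, Set.mem_Ioo, max_lt_iff, lt_min_iff]
    tauto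
  rw [this, Real.volume_Ioo]
  have e1 : (a 3 - a 2) * (s - phi a 0 1 r) =
      thirdMoment a 0 1 3 1 r s + -thirdMoment a 0 1 2 1 r s := by
    simp only [thirdMoment, phi]; ring
  have e2 : (a 3 - a 0) * (s - phi a 1 2 r) =
      thirdMoment a 1 2 3 1 r s + -thirdMoment a 0 1 2 1 r s := by
    simp only [thirdMoment, phi]; ring
  have e3 : (a 1 - a 0) * (s - phi a 2 3 r) =
      thirdMoment a 1 2 3 1 r s + -thirdMoment a 0 2 3 1 r s := by
    simp only [thirdMoment, phi]; ring
  have e4 : (a 1 - a 2) * (s - phi a 0 3 r) =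
      thirdMoment a 0 1 3 1 r s + -thirdMoment a 0 2 3 1 r s := by
    simp only [thirdMoment, phi]; ring
  rw [minForm, e1, e2, e3, e4, sub_eq_add_neg, ← min_neg_neg, add_min, min_add, min_add, min_comm,
    min_comm (thirdMoment a 1 2 3 1 r s + -thirdMoment a 0 1 2 1 r s)]

theorem continuous_thirdMoment (i j k : Fin 4) {X : Type*} [TopologicalSpace X] {u r s : X → ℝ}
    (hu : Continuous u) (hr : Continuous r) (hs : Continuous s) :
    Continuous fun x => thirdMoment a i j k (u x) (r x) (s x) := by
  unfold thirdMoment; fun_prop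

theorem measurableSet_momentCone {X : Type*} [TopologicalSpace X] [MeasurableSpace X]
    [OpensMeasurableSpace X] {u r s w : X → ℝ} (hu : Continuous u) (hr : Continuous r)
    (hs : Continuous s) (hw : Continuous w) :
    MeasurableSet {x | momentCone a (u x) (r x) (s x) (w x)} := by
  have h := fun i j k => continuous_thirdMoment (a := a) i j k hu hr hs
  exact ((isOpen_lt (h _ _ _) hw).inter <| (isOpen_lt (h _ _ _) hw).inter <|
    (isOpen_lt hw (h _ _ _)).inter (isOpen_lt hw (h _ _ _))).measurableSet

theorem volume_normalized_momentCone {B : Set (ℝ × ℝ)} (hB : MeasurableSet B) :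
    volume {q : (ℝ × ℝ) × ℝ | q.1 ∈ B ∧ momentCone a 1 q.1.1 q.1.2 q.2} =
      ∫⁻ q in B, ENNReal.ofReal (minForm a q.1 q.2) := by
  have hm : MeasurableSet {q : (ℝ × ℝ) × ℝ | q.1 ∈ B ∧ momentCone a 1 q.1.1 q.1.2 q.2} :=
    (measurable_fst hB).inter
      (measurableSet_momentCone (by fun_prop) (by fun_prop) (by fun_prop) (by fun_prop))
  rw [Measure.volume_eq_prod, Measure.prod_apply hm, ← lintegral_indicator hB]
  refine lintegral_congr fun q => ?_
  by_cases hq : q ∈ B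
  · rw [Set.indicator_of_mem hq, ← volume_momentCone_slice]
    congr 1
    ext w
    simp [hq]
  · rw [Set.indicator_of_notMem hq]
    convert measure_empty (μ := volume)
    ext w
    simp [hq]

theorem lintegral_Ioo_pow_three : ∫⁻ u in Set.Ioo (0 : ℝ) 1, ENNReal.ofReal |u ^ 3| =
    ENNReal.ofReal (1 / 4) := by
  have : ∀ u ∈ Set.Ioo (0 : ℝ) 1, ENNReal.ofReal |u ^ 3| = ENNReal.ofReal (u ^ 3) :=
    fun u hu => by rw [abs_of_pos (pow_pos hu.1 3)]
  rw [setLIntegral_congr_fun measurableSet_Ioo this, setLIntegral_congr Ioo_ae_eq_Ioc,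
    ← ofReal_integral_eq_lintegral_ofReal, ← intervalIntegral.integral_of_le zero_le_one,
    integral_pow]
  · norm_num
  · exact (intervalIntegrable_iff_integrableOn_Ioc_of_le zero_le_one).1
      (Continuous.intervalIntegrable (by fun_prop) _ _)
  · exact (ae_restrict_mem measurableSet_Ioc).mono fun u hu => pow_nonneg hu.1.le 3

theorem measurableSet_moments {B : Set (ℝ × ℝ)} (hB : MeasurableSet B) :
    MeasurableSet {q : Fin 4 → ℝ | 0 < q 0 ∧ q 0 < 1 ∧
      ((q 0)⁻¹ * q 1, (q 0)⁻¹ * q 2) ∈ B ∧ momentCone a (q 0) (q 1) (q 2) (q 3)} := by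
  have hq : Measurable fun q : Fin 4 → ℝ => ((q 0)⁻¹ * q 1, (q 0)⁻¹ * q 2) := by fun_prop
  have h0 : Measurable fun q : Fin 4 → ℝ => q 0 := by fun_prop
  exact (h0 measurableSet_Ioi).inter <| (h0 measurableSet_Iio).inter <| (hq hB).inter <|
    measurableSet_momentCone (continuous_apply 0) (continuous_apply 1) (continuous_apply 2)
      (continuous_apply 3)

/-- Integration over the cone of moment sequences, in terms of the normalized moments. -/
theorem volume_momentCone {B : Set (ℝ × ℝ)} (hB : MeasurableSet B) :
    volume {q : Fin 4 → ℝ | 0 < q 0 ∧ q 0 < 1 ∧ ((q 0)⁻¹ * q 1, (q 0)⁻¹ * q 2) ∈ B ∧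
      momentCone a (q 0) (q 1) (q 2) (q 3)} =
      ENNReal.ofReal (1 / 4) * ∫⁻ q in B, ENNReal.ofReal (minForm a q.1 q.2) := by
  have hm := measurableSet_moments (a := a) hB
  rw [← volume_preserving_vecCons.measure_preimage hm.nullMeasurableSet, Measure.volume_eq_prod,
    Measure.prod_apply (volume_preserving_vecCons.measurable hm), ← lintegral_Ioo_pow_three,
    ← lintegral_mul_const _ (by fun_prop), ← lintegral_indicator measurableSet_Ioo]
  refine lintegral_congr fun u => ?_
  by_cases hu : u ∈ Set.Ioo (0 : ℝ) 1
  · have : Measure.IsAddHaarMeasure (volume : Measure ((ℝ × ℝ) × ℝ)) := by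
      have : Measure.IsAddHaarMeasure (volume : Measure (ℝ × ℝ)) :=
        Measure.prod.instIsAddHaarMeasure volume volume
      exact Measure.prod.instIsAddHaarMeasure volume volume
    have h3 : Module.finrank ℝ ((ℝ × ℝ) × ℝ) = 3 := by simp
    rw [Set.indicator_of_mem hu, ← volume_normalized_momentCone hB]
    -- The slice at mass `u` is `u` times the slice at mass 1 in dimension 3, whence the weight `u³`
    -- and the factor `1/4`.
    conv_rhs => rw [← h3, ← Measure.addHaar_smul]
    congr 1
    ext ⟨⟨r, s⟩, w⟩
    rw [Set.mem_smul_set_iff_inv_smul_mem₀ hu.1.ne']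
    simp [hu.1, hu.2, momentCone_smul hu.1]
  · rw [Set.indicator_of_notMem hu]
    convert measure_empty (μ := volume)
    ext q
    simp only [Set.mem_Ioo] at hu
    simp
    tauto

/-- Change of variables from positive weights on the points `a i` to their moments. -/
theorem volume_weights (ha : StrictMono a) {B : Set (ℝ × ℝ)} (hB : MeasurableSet B) :
    volume {p : Fin 4 → ℝ | (∀ i, 0 < p i) ∧ ∑ i, p i < 1 ∧
      ((∑ i, p i)⁻¹ * ∑ i, a i * p i, (∑ i, p i)⁻¹ * ∑ i, a i ^ 2 * p i) ∈ B} =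
      ENNReal.ofReal (1 / (4 * V4 a)) * ∫⁻ q in B, ENNReal.ofReal (minForm a q.1 q.2) := by
  have hV := V4_pos ha
  have hdet : (Matrix.vandermonde a).transpose.det = V4 a := by
    rw [Matrix.det_transpose, Matrix.det_vandermonde, V4]
  have hmap := Real.map_matrix_volume_pi_eq_smul_volume_pi (hdet ▸ hV.ne')
  rw [hdet, abs_of_pos (inv_pos.2 hV)] at hmap
  have hL : ∀ p : Fin 4 → ℝ, ∀ k, Matrix.toLin' (Matrix.vandermonde a).transpose p k =
      ∑ i, a i ^ (k : ℕ) * p i := fun p k => by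
    simp [Matrix.mulVec, dotProduct, Matrix.vandermonde_apply]
  set T := {q : Fin 4 → ℝ | 0 < q 0 ∧ q 0 < 1 ∧ ((q 0)⁻¹ * q 1, (q 0)⁻¹ * q 2) ∈ B ∧
      momentCone a (q 0) (q 1) (q 2) (q 3)} with hT
  have hpre : {p : Fin 4 → ℝ | (∀ i, 0 < p i) ∧ ∑ i, p i < 1 ∧
      ((∑ i, p i)⁻¹ * ∑ i, a i * p i, (∑ i, p i)⁻¹ * ∑ i, a i ^ 2 * p i) ∈ B} =
      Matrix.toLin' (Matrix.vandermonde a).transpose ⁻¹' T := by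
    ext p
    have h0 : Matrix.toLin' (Matrix.vandermonde a).transpose p 0 = ∑ i, p i := by simp [hL]
    have h1 : Matrix.toLin' (Matrix.vandermonde a).transpose p 1 = ∑ i, a i * p i := by simp [hL]
    have h2 : Matrix.toLin' (Matrix.vandermonde a).transpose p 2 = ∑ i, a i ^ 2 * p i := hL p 2
    have h3 : Matrix.toLin' (Matrix.vandermonde a).transpose p 3 = ∑ i, a i ^ 3 * p i := hL p 3
    rw [hT, Set.mem_preimage, Set.mem_ofPred_eq, Set.mem_ofPred_eq, h0, h1, h2, h3,
      momentCone_iff ha]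
    have hpos : (∀ i, 0 < p i) → 0 < ∑ i, p i :=
      fun h => Finset.sum_pos (fun i _ => h i) Finset.univ_nonempty
    tauto
  rw [hpre, ← Measure.map_apply (LinearMap.continuous_of_finiteDimensional _).measurable
    (measurableSet_moments hB), hmap, Measure.smul_apply, volume_momentCone hB, smul_eq_mul,
    ← mul_assoc, ← ENNReal.ofReal_mul (inv_pos.2 hV).le]
  congr 2
  field_simp

end RandomState

/-! ### Law of the first two moments and the joint density -/

namespace RandomState

variable {a : Fin 4 → ℝ} {A : Matrix (Fin 4) (Fin 4) ℂ}

/-- A Hermitian matrix with distinct eigenvalues `a i` has an orthonormal eigenbasis indexed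
accordingly. -/
theorem exists_eigenbasis (hA : A.IsHermitian) (ha : StrictMono a)
    (hev : ∀ i, Module.End.HasEigenvalue (Matrix.toLin' A) (a i : ℂ)) :
    ∃ b : OrthonormalBasis (Fin 4) ℂ (EuclideanSpace ℂ (Fin 4)),
      ∀ i, Matrix.toEuclideanLin A (b i) = (a i : ℂ) • b i := by
  have hsym : (Matrix.toEuclideanLin A).IsSymmetric := Matrix.isSymmetric_toEuclideanLin_iff.2 hA
  have hex : ∀ i, ∃ v : EuclideanSpace ℂ (Fin 4), ‖v‖ = 1 ∧
      Matrix.toEuclideanLin A v = (a i : ℂ) • v := by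
    intro i
    obtain ⟨w, hw, hw0⟩ := (hev i).exists_hasEigenvector
    rw [Module.End.mem_eigenspace_iff, Matrix.toLin'_apply] at hw
    set v : EuclideanSpace ℂ (Fin 4) := WithLp.toLp 2 w with hv
    have hv0 : v ≠ 0 := fun h => hw0 (by simpa [hv] using h)
    have hTv : Matrix.toEuclideanLin A v = (a i : ℂ) • v := by
      rw [hv, Matrix.toLpLin_toLp, Matrix.toLin'_apply, hw]; rfl
    refine ⟨((‖v‖⁻¹ : ℝ) : ℂ) • v, ?_, ?_⟩
    · rw [norm_smul, Complex.norm_real, norm_inv, norm_norm, inv_mul_cancel₀ (norm_ne_zero_iff.2 hv0)]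
    · rw [map_smul, hTv, smul_comm]
  choose v hv1 hv using hex
  have hon : Orthonormal ℂ v := by
    refine ⟨hv1, fun i j hij => ?_⟩
    have h := hsym (v i) (v j)
    rw [hv, hv, inner_smul_left, inner_smul_right, Complex.conj_ofReal] at h
    have hne : (a i : ℂ) - a j ≠ 0 := sub_ne_zero.2 fun h => hij (ha.injective (by exact_mod_cast h))
    exact (mul_eq_zero.1 (by rw [sub_mul, h, sub_self] :
      ((a i : ℂ) - a j) * inner ℂ (v i) (v j) = 0)).resolve_left hne
  have hspan : ⊤ ≤ Submodule.span ℂ (Set.range v) := by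
    rw [hon.linearIndependent.span_eq_top_of_card_eq_finrank (by simp)]
  exact ⟨OrthonormalBasis.mk hon hspan, fun i => by rw [OrthonormalBasis.coe_mk]; exact hv i⟩

theorem expVal_eq_sum (b : OrthonormalBasis (Fin 4) ℂ (EuclideanSpace ℂ (Fin 4)))
    {M : Matrix (Fin 4) (Fin 4) ℂ} {c : Fin 4 → ℝ} (hM : M.IsHermitian)
    (hb : ∀ i, Matrix.toEuclideanLin M (b i) = (c i : ℂ) • b i) (ψ : PureState) :
    expVal M ψ = ∑ i, c i * ‖b.repr ψ i‖ ^ 2 := by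
  have hsym : (Matrix.toEuclideanLin M).IsSymmetric := Matrix.isSymmetric_toEuclideanLin_iff.2 hM
  rw [expVal, ← b.sum_inner_mul_inner, Complex.re_sum]
  refine Finset.sum_congr rfl fun i _ => ?_
  rw [← hsym, hb, inner_smul_left, Complex.conj_ofReal, b.repr_apply_apply,
    ← inner_conj_symm (ψ : EuclideanSpace ℂ (Fin 4)) (b i), mul_left_comm, ← Complex.normSq_eq_conj_mul_self,
    Complex.normSq_eq_norm_sq, ← Complex.ofReal_mul, Complex.ofReal_re]

/-- The joint law of the first two moments of `A` in a random state. -/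
theorem uniformState_moments (hA : A.IsHermitian) (ha : StrictMono a)
    (hev : ∀ i, Module.End.HasEigenvalue (Matrix.toLin' A) (a i : ℂ)) {B : Set (ℝ × ℝ)}
    (hB : MeasurableSet B) (hS : Measurable fun ψ => (expVal A ψ, expVal (A ^ 2) ψ)) :
    uniformState {ψ | (expVal A ψ, expVal (A ^ 2) ψ) ∈ B} =
      ENNReal.ofReal (6 / V4 a) * ∫⁻ q in B, ENNReal.ofReal (minForm a q.1 q.2) := by
  obtain ⟨b, hb⟩ := exists_eigenbasis hA ha hev
  have hV := V4_pos ha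
  have hb2 : ∀ i, Matrix.toEuclideanLin (A ^ 2) (b i) = ((a i ^ 2 : ℝ) : ℂ) • b i := by
    intro i
    have : Matrix.toEuclideanLin (A ^ 2) (b i) =
        Matrix.toEuclideanLin A (Matrix.toEuclideanLin A (b i)) := by
      simp [Matrix.toLpLin_apply, pow_two, Matrix.mulVec_mulVec]
    rw [this, hb, map_smul, hb, smul_smul, ← pow_two, Complex.ofReal_pow]
  have hexp := expVal_eq_sum b hA hb
  have hexp2 := expVal_eq_sum b (hA.pow 2) hb2
  set e : EuclideanSpace ℂ (Fin 4) ≃L[ℝ] (Fin 4 → ℂ) :=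
    ((b.repr.toLinearEquiv.trans (EuclideanSpace.equiv (Fin 4) ℂ).toLinearEquiv).restrictScalars
      ℝ).toContinuousLinearEquiv
  have he' : ∀ z i, e z i = b.repr z i := fun z i => rfl
  have he : ∀ z, ∑ i, ‖e z i‖ ^ 2 = ‖z‖ ^ 2 := by
    intro z
    simp only [he']
    rw [← EuclideanSpace.norm_sq_eq, b.repr.norm_map]
  -- `0 < ∑ i, p i` removes the origin, which is not in the open cone and where the normalized
  -- moments take the default value `0`.
  set W := {p : Fin 4 → ℝ | 0 < ∑ i, p i ∧ ∑ i, p i < 1 ∧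
      ((∑ i, p i)⁻¹ * ∑ i, a i * p i, (∑ i, p i)⁻¹ * ∑ i, a i ^ 2 * p i) ∈ B} with hW
  have hWm : MeasurableSet W := by
    have h1 : Measurable fun p : Fin 4 → ℝ => ∑ i, p i := by fun_prop
    have h2 : Measurable fun p : Fin 4 → ℝ =>
      ((∑ i, p i)⁻¹ * ∑ i, a i * p i, (∑ i, p i)⁻¹ * ∑ i, a i ^ 2 * p i) := by fun_prop
    exact (h1 measurableSet_Ioi).inter ((h1 measurableSet_Iio).inter (h2 hB))
  have hn : Measurable fun (z : Fin 4 → ℂ) i => ‖z i‖ ^ 2 := by fun_prop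
  have hcone : Set.Ioo (0 : ℝ) 1 •
      (Subtype.val '' {ψ : PureState | (expVal A ψ, expVal (A ^ 2) ψ) ∈ B}) =
      e ⁻¹' ((fun (z : Fin 4 → ℂ) i => ‖z i‖ ^ 2) ⁻¹' W) := by
    -- Normalized moments are homogeneous of degree 0, hence constant along rays.
    have key : ∀ t : ℝ, t ≠ 0 → ∀ ψ : PureState,
        ((∑ i, ‖e (t • (ψ : EuclideanSpace ℂ (Fin 4))) i‖ ^ 2)⁻¹ *
          ∑ i, a i * ‖e (t • (ψ : EuclideanSpace ℂ (Fin 4))) i‖ ^ 2,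
        (∑ i, ‖e (t • (ψ : EuclideanSpace ℂ (Fin 4))) i‖ ^ 2)⁻¹ *
          ∑ i, a i ^ 2 * ‖e (t • (ψ : EuclideanSpace ℂ (Fin 4))) i‖ ^ 2) =
        (expVal A ψ, expVal (A ^ 2) ψ) := by
      intro t ht ψ
      have h1 : ∀ c : Fin 4 → ℝ, ∑ i, c i * ‖e (t • (ψ : EuclideanSpace ℂ (Fin 4))) i‖ ^ 2 =
          t ^ 2 * ∑ i, c i * ‖b.repr ψ i‖ ^ 2 := by
        intro c
        rw [Finset.mul_sum]
        refine Finset.sum_congr rfl fun i _ => ?_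
        rw [map_smul, Pi.smul_apply, norm_smul, mul_pow, he', Real.norm_eq_abs, sq_abs]
        ring
      have h2 : ‖(ψ : EuclideanSpace ℂ (Fin 4))‖ = 1 := by simp
      rw [he, norm_smul, h2, mul_one, Real.norm_eq_abs, sq_abs, h1, h1, hexp, hexp2,
        inv_mul_cancel_left₀ (pow_ne_zero 2 ht), inv_mul_cancel_left₀ (pow_ne_zero 2 ht)]
    ext z
    simp only [Set.mem_preimage, hW, Set.mem_ofPred_eq, Set.mem_smul, Set.mem_image]
    constructor
    · rintro ⟨t, ht, _, ⟨ψ, hψ, rfl⟩, rfl⟩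
      rw [key t ht.1.ne', he, norm_smul, Real.norm_of_nonneg ht.1.le,
        show ‖(ψ : EuclideanSpace ℂ (Fin 4))‖ = 1 by simp, mul_one]
      exact ⟨pow_pos ht.1 2, pow_lt_one₀ ht.1.le ht.2 two_ne_zero, hψ⟩
    · rintro ⟨h0, h1, hz⟩
      rw [he] at h0 h1
      have hz0 : 0 < ‖z‖ := by
        rcases (norm_nonneg z).eq_or_lt with h | h
        · rw [← h] at h0; norm_num at h0
        · exact h
      have hmem : ‖z‖⁻¹ • z ∈ Metric.sphere (0 : EuclideanSpace ℂ (Fin 4)) 1 := by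
        rw [mem_sphere_zero_iff_norm, norm_smul, norm_inv, norm_norm, inv_mul_cancel₀ hz0.ne']
      have hzz : ‖z‖ • (((⟨‖z‖⁻¹ • z, hmem⟩ : PureState)) : EuclideanSpace ℂ (Fin 4)) = z :=
        smul_inv_smul₀ hz0.ne' z
      have hk := key ‖z‖ hz0.ne' ⟨‖z‖⁻¹ • z, hmem⟩
      rw [hzz] at hk
      rw [hk] at hz
      exact ⟨‖z‖, ⟨hz0, (sq_lt_one_iff₀ (norm_nonneg _)).1 h1⟩, _, ⟨_, hz, rfl⟩, hzz⟩
  rw [uniformState_apply_of_cone e he (S := {ψ | (expVal A ψ, expVal (A ^ 2) ψ) ∈ B}) (hS hB)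
      (hn hWm) hcone, ← Measure.map_apply hn hWm,
    map_norm_sq_volume_pi, Measure.smul_apply, Measure.restrict_apply hWm]
  have hset : W ∩ Set.univ.pi (fun _ => Set.Ioi 0) = {p : Fin 4 → ℝ | (∀ i, 0 < p i) ∧ ∑ i, p i < 1 ∧
      ((∑ i, p i)⁻¹ * ∑ i, a i * p i, (∑ i, p i)⁻¹ * ∑ i, a i ^ 2 * p i) ∈ B} := by
    ext p
    simp only [hW, Set.mem_inter_iff, Set.mem_ofPred_eq, Set.mem_univ_pi, Set.mem_Ioi]
    have hpos : (∀ i, 0 < p i) → 0 < ∑ i, p i :=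
      fun h => Finset.sum_pos (fun i _ => h i) Finset.univ_nonempty
    tauto
  -- The constants combine to `(24 / π⁴) · π⁴ · 1 / (4 V4) = 6 / V4`.
  rw [hset, volume_weights ha hB, smul_eq_mul, ← mul_assoc, ← mul_assoc,
    ← ENNReal.ofReal_mul (by positivity), ← ENNReal.ofReal_mul (by positivity)]
  congr 2
  field_simp
  norm_num

theorem continuous_expVal (M : Matrix (Fin 4) (Fin 4) ℂ) : Continuous (expVal M) := by
  have : Continuous (Matrix.toEuclideanLin M) := LinearMap.continuous_of_finiteDimensional _
  unfold expVal
  fun_prop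

/-- The density of the two moments lives on positive variance, so nothing is lost in `s = x² + r²`.
Between neighbouring eigenvalues `φ_{i,i+1}(r) ≥ r² ≥ s` makes one form nonpositive. -/
theorem minForm_nonpos_of_le_sq (ha : StrictMono a) {r s : ℝ} (h : s ≤ r ^ 2) :
    minForm a r s ≤ 0 := by
  obtain ⟨h1, h2, h3⟩ := strictMono_steps ha
  by_contra! hc
  obtain ⟨p01, p12, p23, p03⟩ := (minForm_pos_iff ha).1 hc
  have q01 := phi_sub_sq (a := a) (r := r) 0 1
  have q12 := phi_sub_sq (a := a) (r := r) 1 2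
  have q23 := phi_sub_sq (a := a) (r := r) 2 3
  rcases le_total r (a 0) with r0 | r0
  · have := mul_nonneg (sub_nonneg.2 r0) (by linarith : 0 ≤ a 3 - a 1)
    simp only [phi] at *; linarith
  rcases le_total r (a 1) with r1 | r1
  · have := mul_nonneg (sub_nonneg.2 r1) (sub_nonneg.2 r0)
    linarith
  rcases le_total r (a 2) with r2 | r2
  · have := mul_nonneg (sub_nonneg.2 r2) (sub_nonneg.2 r1)
    linarith
  rcases le_total r (a 3) with r3 | r3
  · have := mul_nonneg (sub_nonneg.2 r3) (sub_nonneg.2 r2)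
    linarith
  · have := mul_nonneg (sub_nonneg.2 r3) (by linarith : 0 ≤ a 2 - a 0)
    simp only [phi] at *; linarith

theorem measurable_minForm : Measurable fun q : ℝ × ℝ => minForm a q.1 q.2 := by
  simp only [minForm, phi]
  exact Continuous.measurable (by fun_prop)

/-- The substitution `s = x² + r²`. -/
theorem lintegral_minForm_eq_lintegral_jointDensity (ha : StrictMono a) {B : Set (ℝ × ℝ)}
    (hB : MeasurableSet B) :
    ENNReal.ofReal (6 / V4 a) *
        ∫⁻ q in (fun q : ℝ × ℝ => (q.1, √(q.2 - q.1 ^ 2))) ⁻¹' B, ENNReal.ofReal (minForm a q.1 q.2) =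
      ∫⁻ q in B, ENNReal.ofReal (jointDensity a q.1 q.2) := by
  have hV := V4_pos ha
  have hh : Measurable fun q : ℝ × ℝ => (q.1, √(q.2 - q.1 ^ 2)) := by fun_prop
  have hm : Measurable fun q : ℝ × ℝ => ENNReal.ofReal (minForm a q.1 q.2) :=
    measurable_minForm.ennreal_ofReal
  have hj : Measurable fun q : ℝ × ℝ => ENNReal.ofReal (jointDensity a q.1 q.2) :=
    (measurable_jointDensity ha).ennreal_ofReal
  rw [← lintegral_indicator (hh hB), ← lintegral_indicator hB, Measure.volume_eq_prod,
    lintegral_prod _ (hm.indicator (hh hB)).aemeasurable, lintegral_prod _ (hj.indicator hB).aemeasurable,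
    ← lintegral_const_mul' _ _ ENNReal.ofReal_ne_top]
  refine lintegral_congr fun r => ?_
  -- Translating by `r²` makes the variance `y = s - r²` the variable. Both integrands vanish off
  -- the open half-line, where `y = x²` turns `6` into `12 x`.
  rw [← lintegral_add_right_eq_self _ (r ^ 2), ← lintegral_const_mul' _ _ ENNReal.ofReal_ne_top]
  have hz : ∀ y ∉ Set.Ioi (0 : ℝ), ENNReal.ofReal (6 / V4 a) *
      ((fun q : ℝ × ℝ => (q.1, √(q.2 - q.1 ^ 2))) ⁻¹' B).indicator
        (fun q => ENNReal.ofReal (minForm a q.1 q.2)) (r, y + r ^ 2) = 0 := by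
    intro y hy
    have : minForm a r (y + r ^ 2) ≤ 0 :=
      minForm_nonpos_of_le_sq ha (by linarith [Set.notMem_Ioi.1 hy])
    simp [Set.indicator, ENNReal.ofReal_of_nonpos this]
  have hz' : ∀ x ∉ Set.Ioi (0 : ℝ),
      B.indicator (fun q => ENNReal.ofReal (jointDensity a q.1 q.2)) (r, x) = 0 := by
    intro x hx
    have : jointDensity a r x = 0 := by
      rw [jointDensity]
      split_ifs with h
      · rw [le_antisymm (Set.notMem_Ioi.1 hx) h]; simp
      · rfl
    simp [Set.indicator, this]
  rw [← setLIntegral_eq_of_support_subset (Function.support_subset_iff'.2 hz),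
    ← setLIntegral_eq_of_support_subset (Function.support_subset_iff'.2 hz'), lintegral_Ioi_comp_sq]
  refine setLIntegral_congr_fun measurableSet_Ioi fun x hx => ?_
  have hx0 : 0 < x := hx
  by_cases hb : (r, x) ∈ B
  · rw [Set.indicator_of_mem hb, Set.indicator_of_mem, jointDensity_eq ha, if_pos hx0.le,
      ← mul_assoc, ← ENNReal.ofReal_mul (by positivity)]
    · dsimp only
      rw [ENNReal.ofReal_mul (p := 12 / V4 a * x) (by positivity), ENNReal.ofReal_max,
        ENNReal.ofReal_zero, max_eq_right zero_le]
      congr 2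
      ring
    · simpa [Real.sqrt_sq hx0.le] using hb
  · rw [Set.indicator_of_notMem hb, Set.indicator_of_notMem, mul_zero, mul_zero]
    simpa [Real.sqrt_sq hx0.le] using hb

theorem hasDensity_jointDensity (hA : A.IsHermitian) (ha : StrictMono a)
    (hev : ∀ i, Module.End.HasEigenvalue (Matrix.toLin' A) (a i : ℂ)) :
    HasDensity uniformState (fun ψ => (expVal A ψ, uncertainty A ψ))
      (fun p => jointDensity a p.1 p.2) := by
  have c1 := continuous_expVal A
  have c2 := continuous_expVal (A ^ 2)
  have hX : Measurable fun ψ => (expVal A ψ, uncertainty A ψ) := by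
    unfold uncertainty
    exact Continuous.measurable (by fun_prop)
  refine ⟨hX.aemeasurable, measurable_jointDensity ha, fun p => jointDensity_nonneg ha _ _, ?_⟩
  ext B hB
  have hh : Measurable fun q : ℝ × ℝ => (q.1, √(q.2 - q.1 ^ 2)) := by fun_prop
  rw [Measure.map_apply hX hB, withDensity_apply _ hB,
    ← lintegral_minForm_eq_lintegral_jointDensity ha hB,
    ← uniformState_moments hA ha hev (hh hB) (Continuous.measurable (by fun_prop))]
  -- By definition the pair is the image of the first two moments under `(r, s) ↦ (r, √(s - r²))`.
  rfl

end RandomState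

/-! ### The marginal density of the uncertainty, and the regions in the `(r, x)` plane -/

namespace RandomState

variable {a : Fin 4 → ℝ} {A : Matrix (Fin 4) (Fin 4) ℂ}

theorem max_zero_sub_sq_eq_indicator {k : ℝ} (hk : 0 ≤ k) : (fun r : ℝ => max 0 (k - r ^ 2)) =
    (Set.Icc (-√k) √k).indicator fun r => k - r ^ 2 := by
  ext r
  by_cases hr : r ∈ Set.Icc (-√k) √k
  · rw [Set.indicator_of_mem hr, max_eq_right]
    rw [Set.mem_Icc, ← abs_le, Real.le_sqrt (abs_nonneg _) hk, sq_abs] at hr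
    linarith
  · rw [Set.indicator_of_notMem hr, max_eq_left]
    rw [Set.mem_Icc, ← abs_le, Real.le_sqrt (abs_nonneg _) hk, sq_abs] at hr
    linarith

theorem integrable_max_zero_sub_sq (k m : ℝ) : Integrable fun r : ℝ => max 0 (k - (r - m) ^ 2) := by
  rcases le_total k 0 with hk | hk
  · have : (fun r : ℝ => max 0 (k - (r - m) ^ 2)) = 0 := by
      ext r
      exact max_eq_left (by nlinarith [sq_nonneg (r - m)])
    rw [this]
    exact integrable_zero _ _ _
  · have h : Integrable fun r : ℝ => max 0 (k - r ^ 2) := by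
      rw [max_zero_sub_sq_eq_indicator hk, integrable_indicator_iff measurableSet_Icc]
      exact ContinuousOn.integrableOn_Icc (by fun_prop)
    exact h.comp_sub_right m

/-- The parabola is positive on `|r - m| < √k`, giving `2 k^{3/2} - (2/3) k^{3/2}`. For `k ≤ 0` both
sides vanish because `√k = 0`. -/
theorem integral_max_zero_sub_sq (k m : ℝ) :
    ∫ r : ℝ, max 0 (k - (r - m) ^ 2) = 4 / 3 * √k ^ 3 := by
  rw [integral_sub_right_eq_self (fun r : ℝ => max 0 (k - r ^ 2)) m]
  rcases le_total k 0 with hk | hk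
  · have : (fun r : ℝ => max 0 (k - r ^ 2)) = 0 := by
      ext r
      exact max_eq_left (by nlinarith [sq_nonneg r])
    rw [this, Real.sqrt_eq_zero_of_nonpos hk]
    simp
  · rw [max_zero_sub_sq_eq_indicator hk, integral_indicator measurableSet_Icc,
      integral_Icc_eq_integral_Ioc,
      ← intervalIntegral.integral_of_le (by linarith [Real.sqrt_nonneg k]),
      intervalIntegral.integral_sub (by simp) (Continuous.intervalIntegrable (by fun_prop) _ _),
      intervalIntegral.integral_const, integral_pow, smul_eq_mul]
    have := Real.sq_sqrt hk
    push_cast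
    linear_combination (-2 * √k) * this

/-- Completing the square exhibits a parabola centred at the midpoint of the two eigenvalues, with
the radicand of `eps` as its height. -/
theorem phi_sub_eq (i j : Fin 4) (r x : ℝ) : phi a i j r - (x ^ 2 + r ^ 2) =
    ((a i - a j) / 2) ^ 2 - x ^ 2 - (r - (a i + a j) / 2) ^ 2 := by
  simp only [phi]; ring

theorem integrable_max_zero_phi (a : Fin 4 → ℝ) (i j : Fin 4) (x : ℝ) :
    Integrable fun r => max 0 (phi a i j r - (x ^ 2 + r ^ 2)) := by
  simp only [phi_sub_eq]
  exact integrable_max_zero_sub_sq _ _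

theorem integral_max_zero_phi (a : Fin 4 → ℝ) (i j : Fin 4) (x : ℝ) :
    ∫ r, max 0 (phi a i j r - (x ^ 2 + r ^ 2)) = 4 / 3 * eps a i j x ^ 3 := by
  simp only [phi_sub_eq]
  exact integral_max_zero_sub_sq _ _

/-- Beyond the support of the indicator the radicand in `eps` is negative and `√` is already `0`. -/
theorem chi_mul_eps (ha : StrictMono a) {i j : Fin 4} (hij : i < j) {x : ℝ} (hx : 0 ≤ x) (c : ℝ) :
    c * chi a i j x * eps a i j x ^ 3 = c * eps a i j x ^ 3 := by
  have hd := ha hij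
  by_cases h : x ≤ (a j - a i) / 2
  · rw [chi, Set.indicator_of_mem (Set.mem_Icc.2 ⟨hx, h⟩)]
    simp
  · have : eps a i j x = 0 := Real.sqrt_eq_zero_of_nonpos (by nlinarith [not_le.1 h])
    simp [this]

/-- The uncertainty density is the marginal of the joint density. -/
theorem lintegral_jointDensity (ha : StrictMono a) (x : ℝ) :
    0 ≤ uncertaintyDensity a x ∧ ∫⁻ r, ENNReal.ofReal (jointDensity a r x) =
      ENNReal.ofReal (uncertaintyDensity a x) := by
  rcases lt_or_ge x 0 with hx | hx
  · have h0 : ∀ i j, chi a i j x = 0 := fun i j =>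
      Set.indicator_of_notMem (fun h => hx.not_ge h.1) _
    have h1 : uncertaintyDensity a x = 0 := by simp [uncertaintyDensity, h0]
    simp [h1, jointDensity, hx.not_ge]
  have hI := integrable_max_zero_phi a (x := x)
  have hd : (fun r => jointDensity a r x) = fun r => 12 / V4 a * x *
      ((a 3 - a 2) * max 0 (phi a 0 1 r - (x ^ 2 + r ^ 2))
      + (a 3 - a 0) * max 0 (phi a 1 2 r - (x ^ 2 + r ^ 2))
      - (a 3 - a 1) * max 0 (phi a 0 2 r - (x ^ 2 + r ^ 2))
      + (a 1 - a 0) * max 0 (phi a 2 3 r - (x ^ 2 + r ^ 2))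
      - (a 2 - a 0) * max 0 (phi a 1 3 r - (x ^ 2 + r ^ 2))
      + (a 2 - a 1) * max 0 (phi a 0 3 r - (x ^ 2 + r ^ 2))) := by
    ext r
    rw [jointDensity_eq ha, if_pos hx, max_minForm_eq_sum ha (by linarith [sq_nonneg x])]
  have i1 := (hI 0 1).const_mul (a 3 - a 2)
  have i2 := i1.fun_add ((hI 1 2).const_mul (a 3 - a 0))
  have i3 := i2.sub' ((hI 0 2).const_mul (a 3 - a 1))
  have i4 := i3.fun_add ((hI 2 3).const_mul (a 1 - a 0))
  have i5 := i4.sub' ((hI 1 3).const_mul (a 2 - a 0))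
  have i6 := i5.fun_add ((hI 0 3).const_mul (a 2 - a 1))
  have hint : Integrable fun r => jointDensity a r x := by
    rw [hd]
    exact i6.const_mul _
  have heq : ∫ r, jointDensity a r x = uncertaintyDensity a x := by
    rw [hd, integral_const_mul, integral_add i5 ((hI 0 3).const_mul _),
      integral_sub i4 ((hI 1 3).const_mul _), integral_add i3 ((hI 2 3).const_mul _),
      integral_sub i2 ((hI 0 2).const_mul _), integral_add i1 ((hI 1 2).const_mul _)]
    simp only [integral_const_mul, integral_max_zero_phi]
    rw [uncertaintyDensity, chi_mul_eps ha (by decide) hx, chi_mul_eps ha (by decide) hx,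
      chi_mul_eps ha (by decide) hx, chi_mul_eps ha (by decide) hx, chi_mul_eps ha (by decide) hx,
      chi_mul_eps ha (by decide) hx]
    ring
  have hnn := fun r => jointDensity_nonneg ha r x
  rw [← ofReal_integral_eq_lintegral_ofReal hint (ae_of_all _ hnn), heq]
  -- The signed sum is nonnegative because it is the integral of a nonnegative density.
  exact ⟨heq ▸ integral_nonneg hnn, rfl⟩

theorem measurable_uncertaintyDensity (a : Fin 4 → ℝ) : Measurable (uncertaintyDensity a) := by
  have h1 : ∀ i j, Measurable (chi a i j) := fun i j =>
    measurable_one.indicator measurableSet_Icc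
  have h2 : ∀ i j, Measurable (eps a i j) := fun i j => by unfold eps; fun_prop
  unfold uncertaintyDensity
  fun_prop

/-- Marginals: if `(X, Y)` has density `f` and `h` is obtained by integrating out the first
variable, then `Y` has density `h`. -/
theorem HasDensity.snd {Ω : Type*} [MeasurableSpace Ω] {μ : Measure Ω} {X Y : Ω → ℝ}
    {f : ℝ × ℝ → ℝ} {h : ℝ → ℝ} (hf : HasDensity μ (fun ω => (X ω, Y ω)) f) (hm : Measurable h)
    (hh : ∀ y, 0 ≤ h y ∧ ∫⁻ x, ENNReal.ofReal (f (x, y)) = ENNReal.ofReal (h y)) :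
    HasDensity μ Y h := by
  obtain ⟨hXY, hfm, -, hmap⟩ := hf
  refine ⟨measurable_snd.comp_aemeasurable hXY, hm, fun y => (hh y).1, ?_⟩
  have hY : μ.map Y = (μ.map fun ω => (X ω, Y ω)).map Prod.snd :=
    (AEMeasurable.map_map_of_aemeasurable measurable_snd.aemeasurable hXY).symm
  rw [hY, hmap]
  ext B hB
  rw [Measure.map_apply measurable_snd hB, withDensity_apply _ (measurable_snd hB),
    withDensity_apply _ hB, ← lintegral_indicator (measurable_snd hB), ← lintegral_indicator hB,
    Measure.volume_eq_prod,
    lintegral_prod_symm' _ (hfm.ennreal_ofReal.indicator (measurable_snd hB))]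
  refine lintegral_congr fun y => ?_
  by_cases hy : y ∈ B
  · simp [Set.indicator, hy, (hh y).2]
  · simp [Set.indicator, hy]

section regions

variable {r x : ℝ}

theorem mem_regionR_iff (ha : StrictMono a) :
    ((r, x) ∈ R11 a ↔ 0 ≤ x ∧ (r, x ^ 2 + r ^ 2) ∈ D11 a) ∧
    ((r, x) ∈ R12 a ↔ 0 ≤ x ∧ (r, x ^ 2 + r ^ 2) ∈ D12 a) ∧
    ((r, x) ∈ R21 a ↔ 0 ≤ x ∧ (r, x ^ 2 + r ^ 2) ∈ D21 a) ∧
    ((r, x) ∈ R22 a ↔ 0 ≤ x ∧ (r, x ^ 2 + r ^ 2) ∈ D22 a) ∧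
    ((r, x) ∈ R23 a ↔ 0 ≤ x ∧ (r, x ^ 2 + r ^ 2) ∈ D23 a) ∧
    ((r, x) ∈ R24 a ↔ 0 ≤ x ∧ (r, x ^ 2 + r ^ 2) ∈ D24 a) ∧
    ((r, x) ∈ R25 a ↔ 0 ≤ x ∧ (r, x ^ 2 + r ^ 2) ∈ D25 a) ∧
    ((r, x) ∈ R26 a ↔ 0 ≤ x ∧ (r, x ^ 2 + r ^ 2) ∈ D26 a) ∧
    ((r, x) ∈ R31 a ↔ 0 ≤ x ∧ (r, x ^ 2 + r ^ 2) ∈ D31 a) ∧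
    ((r, x) ∈ R32 a ↔ 0 ≤ x ∧ (r, x ^ 2 + r ^ 2) ∈ D32 a) := by
  obtain ⟨h1, h2, h3⟩ := strictMono_steps ha
  obtain ⟨m1, m2⟩ := rMid_mem ha
  refine ⟨?_, ?_, ?_, ?_, ?_, ?_, ?_, ?_, ?_, ?_⟩ <;>
    exact regionR_iff fun r u v => ⟨by linarith, by linarith⟩

theorem jointDensity_eq_zero_of_notMem (ha : StrictMono a) (h : (r, x) ∉ R a) :
    jointDensity a r x = 0 := by
  rw [jointDensity_eq ha]
  split_ifs with hx
  · rw [max_eq_left, mul_zero]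
    by_contra! hc
    have hD := mem_regions_of_minForm_pos ha hc
    obtain ⟨k1, k2, k3, k4, k5, k6, k7, k8, k9, k10⟩ := mem_regionR_iff (r := r) (x := x) ha
    simp only [hx, true_and] at k1 k2 k3 k4 k5 k6 k7 k8 k9 k10
    simp only [R, Set.mem_union, k1, k2, k3, k4, k5, k6, k7, k8, k9, k10] at h
    rcases hD with (q | q) | (q | q) | (q | q) | ((q | q) | q) | q <;>
      exact h (by simp only [q, true_or, or_true])
  · rfl

end regions

end RandomState

theorem mainTheorem8 (A : Matrix (Fin 4) (Fin 4) ℂ) (hA : A.IsHermitian)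
    (a : Fin 4 → ℝ) (ha : StrictMono a)
    (hev : ∀ i, Module.End.HasEigenvalue (Matrix.toLin' A) (a i : ℂ)) :
    -- the joint density of the expectation value and the uncertainty
    RandomState.HasDensity RandomState.uniformState
      (fun ψ => (RandomState.expVal A ψ, RandomState.uncertainty A ψ))
      (fun p => RandomState.jointDensity a p.1 p.2) ∧
    -- its explicit form on the regions, and its vanishing elsewhere
    (∀ r x : ℝ, (r, x) ∈ RandomState.R11 a ∪ RandomState.R22 a →
      RandomState.jointDensity a r x = 12 / RandomState.V4 a * x *
        ((a 3 - a 2) * (x ^ 2 + r ^ 2 - RandomState.phi a 0 1 r))) ∧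
    (∀ r x : ℝ, (r, x) ∈ RandomState.R21 a ∪ RandomState.R24 a →
      RandomState.jointDensity a r x = 12 / RandomState.V4 a * x *
        ((a 3 - a 0) * (x ^ 2 + r ^ 2 - RandomState.phi a 1 2 r))) ∧
    (∀ r x : ℝ, (r, x) ∈ RandomState.R25 a ∪ RandomState.R31 a →
      RandomState.jointDensity a r x = 12 / RandomState.V4 a * x *
        ((a 1 - a 0) * (x ^ 2 + r ^ 2 - RandomState.phi a 2 3 r))) ∧
    (∀ r x : ℝ, (r, x) ∈ RandomState.R12 a ∪ RandomState.R23 a ∪ RandomState.R26 a ∪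
        RandomState.R32 a →
      RandomState.jointDensity a r x = 12 / RandomState.V4 a * x *
        ((a 1 - a 2) * (x ^ 2 + r ^ 2 - RandomState.phi a 0 3 r))) ∧
    (∀ r x : ℝ, (r, x) ∉ RandomState.R a → RandomState.jointDensity a r x = 0) ∧
    -- the density of the uncertainty
    RandomState.HasDensity RandomState.uniformState (RandomState.uncertainty A)
      (RandomState.uncertaintyDensity a) := by
  have hD := RandomState.hasDensity_jointDensity hA ha hev
  refine ⟨hD, fun r x h => ?_, fun r x h => ?_, fun r x h => ?_, fun r x h => ?_,
    fun r x h => RandomState.jointDensity_eq_zero_of_notMem ha h,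
    hD.snd (RandomState.measurable_uncertaintyDensity a) (RandomState.lintegral_jointDensity ha)⟩ <;>
  obtain ⟨k1, k2, k3, k4, k5, k6, k7, k8, k9, k10⟩ :=
    RandomState.mem_regionR_iff (r := r) (x := x) ha <;>
  simp only [Set.mem_union, k1, k2, k3, k4, k5, k6, k7, k8, k9, k10, ← and_or_left] at h
  · exact RandomState.jointDensity_of_max_minForm ha h.1
      (RandomState.max_minForm_of_mem_D11_D22 ha h.2)
  · exact RandomState.jointDensity_of_max_minForm ha h.1
      (RandomState.max_minForm_of_mem_D21_D24 ha h.2)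
  · exact RandomState.jointDensity_of_max_minForm ha h.1
      (RandomState.max_minForm_of_mem_D25_D31 ha h.2)
  · exact RandomState.jointDensity_of_max_minForm ha h.1
      (RandomState.max_minForm_of_mem_D12_D23_D26_D32 ha h.2)
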